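/- Theorem 3 (inapproximability). A function $F\colon[0,1]^n\to\mathbb R$ is DR-submodular if $F(a+te_i)-F(a)\ge F(b+te_i)-F(b)$ for all $a\le b$ (coordinate-wise) in $[0,1]^n$, all coordinates $i$ and all $t>0$ with $b+te_i\in[0,1]^n$; it is $\beta$-smooth if it is continuously differentiable and $\|\nabla F(x)-\nabla F(y)\|_2\le\beta\|x-y\|_2$ for all $x,y\in[0,1]^n$. Polytopes $K\subseteq[0,1]^n$ are called solvable if linear functions can be maximized over them in time polynomial in $n$; here this means that a single real-RAM program (exact real arithmetic and comparisons, real constants allowed), given $n$ and $w\in\mathbb R^n$, outputs a maximizer of $\langle w,x\rangle$ over $x\in K$ within $T(n)$ steps, for a fixed polynomial $T$. A function $P\colon\mathbb N\to\mathbb N$ is sub-exponential if $P(n)\le e^{\delta n}$ for every $\delta>0$ and all sufficiently large $n$. There are an absolute constant $c>0$ and an absolute polynomial $\beta$ such that the following holds for all $h\in[0,1)$ and $\varepsilon>0$. There are a real-RAM program $M$ and a polynomial $T$ such that, for every sub-exponential function $P$ and every $N$, there is no randomized algorithm with the following guarantee: for every $n\ge N$, every polytope $K\subseteq[0,1]^n$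 with $\min_{x\in K}\|x\|_\infty=h$ over which $M$ maximizes every linear function within $T(n)$ steps, and every non-negative, DR-submodular, $\beta(n)$-smooth (in particular continuously differentiable) function $F\colon[0,1]^n\to\mathbb R_{\ge0}$ with $\max_{x\in K}F(x)\ge c/n$, the algorithm, which knows $n$ and $K$ and accesses $F$ only by (adaptively chosen) queries for its value or its gradient at points of $[0,1]^n$, makes almost surely at most $P(n)$ queries, outputs almost surely a point $a\in K$, and satisfies $$\mathbb E[F(a)]\;\ge\;\Bigl(\tfrac14(1-h)+\varepsilon\Bigr)\cdot\max_{x\in K}F(x).$$ The computation of the algorithm between queries is not restricted; in particular, no algorithm (deterministic or randomized) running in sub-exponential time has this guarantee. -/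

import Mathlib

open MeasureTheory

namespace DRHardness

/-! ### Functions on the unit cube -/

/-- `ℝⁿ` with the Euclidean norm. -/
abbrev Vec (n : ℕ) : Type := EuclideanSpace ℝ (Fin n)

/-- The cube `[0,1]ⁿ`. -/
def cube (n : ℕ) : Set (Vec n) := {x | ∀ i, x i ∈ Set.Icc (0 : ℝ) 1}

/-- The gradient of `F` as a function on the cube (one-sided at the boundary). -/
noncomputable def cubeGradient {n : ℕ} (F : Vec n → ℝ) (x : Vec n) : Vec n :=
  gradientWithin F (cube n) x

/-- DR-submodularity on the cube. -/
def DRSubmodular {n : ℕ} (F : Vec n → ℝ) : Prop :=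
  ∀ a ∈ cube n, ∀ b ∈ cube n, ∀ k : ℝ, 0 < k → ∀ i : Fin n,
    (∀ j, a j ≤ b j) → b + k • EuclideanSpace.single i (1 : ℝ) ∈ cube n →
      F (b + k • EuclideanSpace.single i (1 : ℝ)) - F b ≤
        F (a + k • EuclideanSpace.single i (1 : ℝ)) - F a

/-- `β`-smoothness on the cube: continuously differentiable, with a gradient that is
`β`-Lipschitz in the Euclidean norm. -/
def Smooth {n : ℕ} (β : ℝ) (F : Vec n → ℝ) : Prop :=
  ContDiffOn ℝ 1 F (cube n) ∧
    ∀ x ∈ cube n, ∀ y ∈ cube n, ‖cubeGradient F x - cubeGradient F y‖ ≤ β * ‖x - y‖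

/-- A polytope: the convex hull of finitely many points. -/
def IsPolytope {n : ℕ} (K : Set (Vec n)) : Prop :=
  ∃ S : Set (Vec n), S.Finite ∧ K = convexHull ℝ S

/-! ### A real RAM with a step count -/

/-- A memory state: natural-number registers `idx` and real-valued cells `mem`. -/
structure RamState where
  idx : ℕ → ℕ
  mem : ℕ → ℝ

/-- Programs of a real RAM. Real cells are addressed through the index registers; programs may
contain real constants; there is no rounding operation. -/
inductive RamProg : Type
  /-- `idx r := a` -/
  | setIdx (r a : ℕ)
  /-- `idx r := idx s + idx t` -/
  | addIdx (r s t : ℕ)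
  /-- `idx r := idx s - idx t` (truncated) -/
  | subIdx (r s t : ℕ)
  /-- `mem[idx r] := a` -/
  | setMem (r : ℕ) (a : ℝ)
  /-- `mem[idx r] := mem[idx s]` -/
  | copyMem (r s : ℕ)
  /-- `mem[idx r] := mem[idx s] + mem[idx t]` -/
  | addMem (r s t : ℕ)
  /-- `mem[idx r] := mem[idx s] - mem[idx t]` -/
  | subMem (r s t : ℕ)
  /-- `mem[idx r] := mem[idx s] * mem[idx t]` -/
  | mulMem (r s t : ℕ)
  /-- `mem[idx r] := mem[idx s] / mem[idx t]` -/
  | divMem (r s t : ℕ)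
  /-- `p; q` -/
  | seq (p q : RamProg)
  /-- `if idx r ≤ idx s then p else q` -/
  | iteIdx (r s : ℕ) (p q : RamProg)
  /-- `if mem[idx r] ≤ mem[idx s] then p else q` -/
  | iteMem (r s : ℕ) (p q : RamProg)
  /-- `while idx r < idx s do p` -/
  | whileLt (r s : ℕ) (p : RamProg)

namespace RamState

/-- Overwrite an index register. -/
def setIdx (σ : RamState) (r a : ℕ) : RamState := { σ with idx := Function.update σ.idx r a }

/-- The content of the real cell whose address is held in index register `r`. -/
def get (σ : RamState) (r : ℕ) : ℝ := σ.mem (σ.idx r)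

/-- Overwrite the real cell whose address is held in index register `r`. -/
noncomputable def put (σ : RamState) (r : ℕ) (a : ℝ) : RamState :=
  { σ with mem := Function.update σ.mem (σ.idx r) a }

/-- The initial state on input `c ∈ ℝⁿ`: the dimension is in register `0`, the coordinates of `c`
are in the cells `0, …, n - 1`, and everything else is `0`. -/
noncomputable def init {n : ℕ} (c : Vec n) : RamState where
  idx := fun r => if r = 0 then n else 0
  mem := fun i => if hi : i < n then c ⟨i, hi⟩ else 0

/-- The vector in the cells `0, …, n - 1`. -/
noncomputable def out (n : ℕ) (σ : RamState) : Vec n := WithLp.toLp 2 fun i : Fin n => σ.mem i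

end RamState

/-- `Exec p σ τ t`: started in state `σ`, the program `p` halts in state `τ` after `t` steps,
where each elementary instruction and each test counts as one step. -/
inductive Exec : RamProg → RamState → RamState → ℕ → Prop
  | setIdx (r a : ℕ) (σ : RamState) : Exec (.setIdx r a) σ (σ.setIdx r a) 1
  | addIdx (r s t : ℕ) (σ : RamState) :
      Exec (.addIdx r s t) σ (σ.setIdx r (σ.idx s + σ.idx t)) 1
  | subIdx (r s t : ℕ) (σ : RamState) :
      Exec (.subIdx r s t) σ (σ.setIdx r (σ.idx s - σ.idx t)) 1
  | setMem (r : ℕ) (a : ℝ) (σ : RamState) : Exec (.setMem r a) σ (σ.put r a) 1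
  | copyMem (r s : ℕ) (σ : RamState) : Exec (.copyMem r s) σ (σ.put r (σ.get s)) 1
  | addMem (r s t : ℕ) (σ : RamState) :
      Exec (.addMem r s t) σ (σ.put r (σ.get s + σ.get t)) 1
  | subMem (r s t : ℕ) (σ : RamState) :
      Exec (.subMem r s t) σ (σ.put r (σ.get s - σ.get t)) 1
  | mulMem (r s t : ℕ) (σ : RamState) :
      Exec (.mulMem r s t) σ (σ.put r (σ.get s * σ.get t)) 1
  | divMem (r s t : ℕ) (σ : RamState) :
      Exec (.divMem r s t) σ (σ.put r (σ.get s / σ.get t)) 1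
  | seq {p q : RamProg} {σ τ υ : RamState} {t u : ℕ} :
      Exec p σ τ t → Exec q τ υ u → Exec (.seq p q) σ υ (t + u)
  | iteIdx_true {r s : ℕ} {p q : RamProg} {σ τ : RamState} {t : ℕ} :
      σ.idx r ≤ σ.idx s → Exec p σ τ t → Exec (.iteIdx r s p q) σ τ (t + 1)
  | iteIdx_false {r s : ℕ} {p q : RamProg} {σ τ : RamState} {t : ℕ} :
      ¬ σ.idx r ≤ σ.idx s → Exec q σ τ t → Exec (.iteIdx r s p q) σ τ (t + 1)
  | iteMem_true {r s : ℕ} {p q : RamProg} {σ τ : RamState} {t : ℕ} :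
      σ.get r ≤ σ.get s → Exec p σ τ t → Exec (.iteMem r s p q) σ τ (t + 1)
  | iteMem_false {r s : ℕ} {p q : RamProg} {σ τ : RamState} {t : ℕ} :
      ¬ σ.get r ≤ σ.get s → Exec q σ τ t → Exec (.iteMem r s p q) σ τ (t + 1)
  | while_done {r s : ℕ} {p : RamProg} {σ : RamState} :
      ¬ σ.idx r < σ.idx s → Exec (.whileLt r s p) σ σ 1
  | while_loop {r s : ℕ} {p : RamProg} {σ τ υ : RamState} {t u : ℕ} :
      σ.idx r < σ.idx s → Exec p σ τ t → Exec (.whileLt r s p) τ υ u →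
        Exec (.whileLt r s p) σ υ (t + u + 1)

/-- For every `c ∈ ℝⁿ`, the program `M` finds within `T` steps a point of `K` that maximizes the
linear function `⟨c, ·⟩` over `K`. -/
def SolvesLinear (M : RamProg) (T : ℕ) {n : ℕ} (K : Set (Vec n)) : Prop :=
  ∀ c : Vec n, ∃ (τ : RamState) (t : ℕ), Exec M (RamState.init c) τ t ∧ t ≤ T ∧
    τ.out n ∈ K ∧ ∀ y ∈ K, inner ℝ c y ≤ inner ℝ c (τ.out n)

/-! ### Algorithms with oracle access to the objective -/

/-- A deterministic adaptive algorithm in dimension `n`: it outputs a point, or it asks for the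
value or the gradient of the objective at a point of the cube and continues according to the
answer. The computation between the queries is not restricted. -/
inductive QueryAlg (n : ℕ) : Type
  | output (x : Vec n)
  | value (x : cube n) (next : ℝ → QueryAlg n)
  | gradient (x : cube n) (next : Vec n → QueryAlg n)

namespace QueryAlg

/-- The output of the algorithm when the objective is `F`. -/
noncomputable def result {n : ℕ} (F : Vec n → ℝ) : QueryAlg n → Vec n
  | output x => x
  | value x next => (next (F x)).result F
  | gradient x next => (next (cubeGradient F x)).result F

/-- The number of queries made by the algorithm when the objective is `F`. -/
noncomputable def queries {n : ℕ} (F : Vec n → ℝ) : QueryAlg n → ℕ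
  | output _ => 0
  | value x next => (next (F x)).queries F + 1
  | gradient x next => (next (cubeGradient F x)).queries F + 1

end QueryAlg

/-- A randomized algorithm with random seed in `Ω`. It knows the dimension and the constraint set,
and accesses the objective through queries. -/
abbrev RandAlg (Ω : Type*) : Type _ := (n : ℕ) → Set (Vec n) → Ω → QueryAlg n

/-- `P(n) = exp(o(n))`. -/
def SubExponential (P : ℕ → ℕ) : Prop :=
  ∀ δ : ℝ, 0 < δ → ∀ᶠ n : ℕ in Filter.atTop, (P n : ℝ) ≤ Real.exp (δ * n)

/-- The instances `max {F x | x ∈ K}` in dimension `n`, with optimal value `opt`: the objective is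
non-negative, DR-submodular and `β(n)`-smooth (in particular continuously differentiable), the
constraint set is a polytope in the cube whose points have minimal `ℓ_∞`-norm `h` and over which
the program `M` maximizes linear functions in time `T(n)`, and the optimal value is at least
`c / n`. -/
structure IsInstance (h c : ℝ) (β T : Polynomial ℕ) (M : RamProg)
    (n : ℕ) (K : Set (Vec n)) (F : Vec n → ℝ) (opt : ℝ) : Prop where
  polytope : IsPolytope K
  subset_cube : K ⊆ cube n
  solvable : SolvesLinear M (T.eval n) K
  min_norm : IsLeast ((fun x : Vec n => ‖WithLp.ofLp x‖) '' K) h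
  nonneg : ∀ x ∈ cube n, 0 ≤ F x
  contDiffOn : ContDiffOn ℝ 1 F (cube n)
  drSubmodular : DRSubmodular F
  smooth : Smooth ((β.eval n : ℕ) : ℝ) F
  isGreatest : IsGreatest (F '' K) opt
  opt_lower : c / n ≤ opt

/-- On every instance of the class `I` of dimension at least `N`, the randomized algorithm `A`
almost surely makes at most `P(n)` queries and outputs a feasible point, and the expected value of
its output is at least `α` times the optimal value. -/
def Achieves {Ω : Type*} [MeasurableSpace Ω] (μ : Measure Ω) (A : RandAlg Ω) (P : ℕ → ℕ) (α : ℝ)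
    (I : (n : ℕ) → Set (Vec n) → (Vec n → ℝ) → ℝ → Prop) (N : ℕ) : Prop :=
  ∀ (n : ℕ) (K : Set (Vec n)) (F : Vec n → ℝ) (opt : ℝ), N ≤ n → I n K F opt →
    (∀ᵐ ω ∂μ, (A n K ω).queries F ≤ P n ∧ (A n K ω).result F ∈ K) ∧
      ENNReal.ofReal (α * opt) ≤ ∫⁻ ω, ENNReal.ofReal (F ((A n K ω).result F)) ∂μ

end DRHardness

open DRHardness

namespace DRHardness

/-! ### A logarithmic-scale cutoff -/

/-! The proof is a symmetry-gap argument. Coordinates form `m` blocks of two rows of `k`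
coordinates, and the polytope is the `m`-fold product of the convex hull of `(0, h 1)` and the
points `(eⱼ, 1 - eⱼ)`. A hidden `σ` selects one column per block. Let `a, b` be the means over the
selected entries of the two rows, and `ā, b̄` the means over all entries.

Without a cutoff the main term is `a (1 - b) + (kā - a)(k - 1 - (kb̄ - b)) / (k - 1)`, which equals
`kā (1 - b̄) - k/(k - 1) · (a - ā)(b - b̄)`. The vertex chosen by `σ` gives it the value `1`. If the
covariance term is dropped, only `kā (1 - b̄)` remains. On the polytope, with `s = kā`, this is `(1
- h) s (1 - s) + s²/k`, hence at most `(1 - h)/4 + 1/k`. The ratio of the two values is the claimed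
barrier.

To hide `σ`, the covariance is multiplied by a cutoff `Φ` that vanishes when `(a - ā)² + (b - b̄)²`
is small (`exists_isCutoff`). Varying on a logarithmic scale, `Φ` perturbs the second derivatives by
at most `γ`. The height `1 - γ` of `Φ` and a concave term of size `η` absorb this perturbation and
restore DR-submodularity (`gradient_change_nonpos`, `objGrad_antitone`).

For a fixed point, a random `σ` gives `a ≈ ā` and `b ≈ b̄` up to probability `exp(-Ω(m))`
(`card_not_near_le`). Value and gradient there then do not depend on `σ`. Nor does the polytope, so
sub-exponentially many queries reveal almost nothing (`card_result_not_good_le`). Averaging over `σ`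
gives the contradiction. The number `k` depends only on `h` and `ε`, so one program optimizes block
by block over `k + 1` vertices (`exists_solvesLinear`); only `m` tends to infinity. -/

lemma exists_bound_of_eq_zero_off_Icc {f : ℝ → ℝ} (hf : Continuous f)
    (h0 : ∀ x, x < 0 → f x = 0) (h1 : ∀ x, 1 < x → f x = 0) :
    ∃ C, 0 ≤ C ∧ ∀ x, |f x| ≤ C := by
  obtain ⟨C, hC⟩ := (isCompact_Icc (a := (0 : ℝ)) (b := 1)).exists_bound_of_continuousOn
    hf.continuousOn
  refine ⟨max C 0, le_max_right _ _, fun x => ?_⟩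
  by_cases hx0 : x < 0
  · simp [h0 x hx0]
  by_cases hx1 : 1 < x
  · simp [h1 x hx1]
  exact (hC x ⟨not_lt.1 hx0, not_lt.1 hx1⟩).trans (le_max_left _ _)

/-- A smooth step from `0` to `1` with bounded first and second derivatives. -/
lemma exists_step : ∃ (S S' S'' : ℝ → ℝ) (C : ℝ), 0 ≤ C ∧ ContDiff ℝ 2 S ∧
    (∀ x, HasDerivAt S (S' x) x) ∧ (∀ x, HasDerivAt S' (S'' x) x) ∧
    (∀ x, |S' x| ≤ C) ∧ (∀ x, |S'' x| ≤ C) ∧ (∀ x, 0 ≤ S x) ∧ (∀ x, S x ≤ 1) ∧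
    (∀ x, x ≤ 0 → S x = 0) ∧ (∀ x, 1 ≤ x → S x = 1) := by
  have hS : ContDiff ℝ 2 Real.smoothTransition := Real.smoothTransition.contDiff
  have hS' : ContDiff ℝ 1 (deriv Real.smoothTransition) := by
    have := (contDiff_succ_iff_deriv (n := 1) (f := Real.smoothTransition)).1
      (by exact_mod_cast hS)
    exact this.2.2
  have hS'' : Continuous (deriv (deriv Real.smoothTransition)) := hS'.continuous_deriv le_rfl
  have l0 : ∀ x : ℝ, x < 0 → Real.smoothTransition =ᶠ[nhds x] fun _ => 0 := fun x hx => by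
    filter_upwards [Iio_mem_nhds hx] with y hy
    exact Real.smoothTransition.zero_of_nonpos (le_of_lt hy)
  have l1 : ∀ x : ℝ, 1 < x → Real.smoothTransition =ᶠ[nhds x] fun _ => 1 := fun x hx => by
    filter_upwards [Ioi_mem_nhds hx] with y hy
    exact Real.smoothTransition.one_of_one_le (le_of_lt hy)
  obtain ⟨C₁, h₁, hC₁⟩ := exists_bound_of_eq_zero_off_Icc hS'.continuous
    (fun x hx => by simpa using (l0 x hx).deriv_eq) (fun x hx => by simpa using (l1 x hx).deriv_eq)
  obtain ⟨C₂, h₂, hC₂⟩ := exists_bound_of_eq_zero_off_Icc hS''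
    (fun x hx => by simpa using (l0 x hx).deriv.deriv_eq)
    (fun x hx => by simpa using (l1 x hx).deriv.deriv_eq)
  refine ⟨Real.smoothTransition, deriv Real.smoothTransition,
    deriv (deriv Real.smoothTransition), C₁ + C₂, by positivity, hS,
    fun x => (hS.differentiable (by norm_num) x).hasDerivAt,
    fun x => (hS'.differentiable (by norm_num) x).hasDerivAt,
    fun x => (hC₁ x).trans (by linarith), fun x => (hC₂ x).trans (by linarith),
    Real.smoothTransition.nonneg, Real.smoothTransition.le_one,
    fun x => Real.smoothTransition.zero_of_nonpos, fun x => Real.smoothTransition.one_of_one_le⟩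

/-- `Φ` is a cutoff that varies so slowly that `s Φ'(s)` and `s² Φ''(s)` are at most of order `γ`;
it vanishes on `[-s₀, s₀]` and equals `1 - γ` on `[1/2, ∞)`. -/
structure IsCutoff (γ s₀ : ℝ) (Φ Φ' Φ'' : ℝ → ℝ) : Prop where
  contDiff : ContDiff ℝ 2 Φ
  hasDerivAt : ∀ s, HasDerivAt Φ (Φ' s) s
  hasDerivAt' : ∀ s, HasDerivAt Φ' (Φ'' s) s
  nonneg : ∀ s, 0 ≤ Φ s
  le : ∀ s, Φ s ≤ 1 - γ
  eq_zero : ∀ s, |s| ≤ s₀ → Φ s = 0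
  eq_top : ∀ s, 1 / 2 ≤ s → Φ s = 1 - γ
  bound : ∀ s, 0 ≤ s → 3 * |s * Φ' s| + 4 * |s ^ 2 * Φ'' s| ≤ γ

/-- A step function of `log s`, stretched over a logarithmic interval of length `Λ`, has `s Φ'` and
`s² Φ''` of order `1 / Λ`. The price is an `s₀` exponentially small in `Λ`, which is still a
constant independent of the dimension. -/
lemma exists_isCutoff {γ : ℝ} (hγ0 : 0 < γ) (hγ1 : γ < 1) :
    ∃ (s₀ : ℝ) (Φ Φ' Φ'' : ℝ → ℝ), 0 < s₀ ∧ IsCutoff γ s₀ Φ Φ' Φ'' := by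
  obtain ⟨S, S', S'', C, hC, hS, dS, dS', bS', bS'', S0, S1, Sz, So⟩ := exists_step
  -- With `Λ ≥ 1`, `|s Φ'| ≤ C / Λ` and `|s² Φ''| ≤ 2 C / Λ`, so the weights `3` and `4` in
  -- `IsCutoff.bound` add up to `3 + 4 · 2 = 11`.
  set Λ : ℝ := 1 + 11 * C / γ with hΛ
  have hΛ1 : 1 ≤ Λ := by rw [hΛ]; have : 0 ≤ 11 * C / γ := by positivity
                         linarith
  have hΛ0 : 0 < Λ := by linarith
  have hΛγ : 11 * C ≤ γ * Λ := by
    rw [hΛ]; field_simp; nlinarith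
  set t₀ : ℝ := Real.log (1 / 2) - Λ with ht₀
  set s₀ : ℝ := Real.exp t₀ with hs₀
  have hs₀pos : 0 < s₀ := Real.exp_pos _
  set Ψ : ℝ → ℝ := fun s => (1 - γ) * S ((Real.log s - t₀) / Λ) with hΨ
  -- Since `Real.log 0 = 0`, the formula `Ψ` takes the wrong value `1 - γ` at `0`. For negative `s`
  -- it is the even extension.
  set Φ : ℝ → ℝ := fun s => if s = 0 then 0 else Ψ s with hΦ
  have hz : ∀ s, |s| ≤ s₀ → Φ s = 0 := by
    intro s hs
    by_cases h : s = 0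
    · simp [hΦ, h]
    have hlog : Real.log s ≤ t₀ := by
      rw [← Real.log_abs, Real.log_le_iff_le_exp (abs_pos.2 h)]
      exact hs
    have : (Real.log s - t₀) / Λ ≤ 0 := div_nonpos_of_nonpos_of_nonneg (by linarith) hΛ0.le
    simp [hΦ, hΨ, h, Sz _ this]
  have hloc0 : Φ =ᶠ[nhds 0] fun _ => 0 := by
    filter_upwards [Metric.ball_mem_nhds (0 : ℝ) hs₀pos] with s hs
    rw [mem_ball_zero_iff, Real.norm_eq_abs] at hs
    exact hz s hs.le
  have hloc : ∀ s, s ≠ 0 → Φ =ᶠ[nhds s] Ψ := by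
    intro s hs
    filter_upwards [isOpen_ne.mem_nhds hs] with y hy
    simp only [hΦ]
    rw [if_neg hy]
  have hcd : ContDiff ℝ 2 Φ := by
    rw [contDiff_iff_contDiffAt]
    intro s
    by_cases hs : s = 0
    · subst hs
      exact contDiffAt_const.congr_of_eventuallyEq hloc0
    · refine ContDiffAt.congr_of_eventuallyEq ?_ (hloc s hs)
      exact contDiffAt_const.mul (hS.contDiffAt.comp s
        (((Real.contDiffAt_log.2 hs).sub contDiffAt_const).div_const _))
  have hcd' : ContDiff ℝ 1 (deriv Φ) :=
    ((contDiff_succ_iff_deriv (n := 1) (f := Φ)).1 (by exact_mod_cast hcd)).2.2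
  have dΨ : ∀ s, s ≠ 0 → HasDerivAt Ψ ((1 - γ) / Λ * (S' ((Real.log s - t₀) / Λ) * s⁻¹)) s := by
    intro s hs
    have h1 : HasDerivAt (fun s => (Real.log s - t₀) / Λ) (s⁻¹ / Λ) s :=
      ((Real.hasDerivAt_log hs).sub_const _).div_const _
    have h2 := ((dS ((Real.log s - t₀) / Λ)).comp s h1).const_mul (1 - γ)
    refine h2.congr_deriv ?_
    ring
  have dΨ' : ∀ s, s ≠ 0 → HasDerivAt (fun s => (1 - γ) / Λ * (S' ((Real.log s - t₀) / Λ) * s⁻¹))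
      ((1 - γ) / Λ * (S'' ((Real.log s - t₀) / Λ) / Λ - S' ((Real.log s - t₀) / Λ)) / s ^ 2) s := by
    intro s hs
    have h1 : HasDerivAt (fun s => (Real.log s - t₀) / Λ) (s⁻¹ / Λ) s :=
      ((Real.hasDerivAt_log hs).sub_const _).div_const _
    have h2 := (((dS' ((Real.log s - t₀) / Λ)).comp s h1).mul (hasDerivAt_inv hs)).const_mul
      ((1 - γ) / Λ)
    refine h2.congr_deriv ?_
    simp only [Function.comp]
    field_simp
    ring
  have eΦ' : ∀ s, s ≠ 0 → deriv Φ s = (1 - γ) / Λ * (S' ((Real.log s - t₀) / Λ) * s⁻¹) :=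
    fun s hs => (hloc s hs).deriv_eq.trans (dΨ s hs).deriv
  have eΦ'' : ∀ s, s ≠ 0 → deriv (deriv Φ) s =
      (1 - γ) / Λ * (S'' ((Real.log s - t₀) / Λ) / Λ - S' ((Real.log s - t₀) / Λ)) / s ^ 2 := by
    intro s hs
    refine Filter.EventuallyEq.deriv_eq ?_ |>.trans (dΨ' s hs).deriv
    filter_upwards [isOpen_ne.mem_nhds hs] with y hy
    exact eΦ' y hy
  refine ⟨s₀, Φ, deriv Φ, deriv (deriv Φ), hs₀pos, hcd,
    fun s => (hcd.differentiable (by norm_num) s).hasDerivAt,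
    fun s => (hcd'.differentiable (by norm_num) s).hasDerivAt, fun s => ?_, fun s => ?_, hz,
    fun s hs => ?_, fun s hs => ?_⟩
  · by_cases h : s = 0
    · simp [hΦ, h]
    · simp only [hΦ, hΨ, if_neg h]
      exact mul_nonneg (by linarith) (S0 _)
  · by_cases h : s = 0
    · simp only [hΦ, if_pos h]
      linarith
    · simp only [hΦ, hΨ, if_neg h]
      exact mul_le_of_le_one_right (by linarith) (S1 _)
  · have h : s ≠ 0 := by linarith
    simp only [hΦ, hΨ, if_neg h]
    rw [So, mul_one]
    rw [le_div_iff₀ hΛ0]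
    have : Real.log (1 / 2) ≤ Real.log s := Real.log_le_log (by norm_num) hs
    rw [ht₀]
    linarith
  · rcases hs.eq_or_lt with rfl | hs
    · simpa using hγ0.le
    rw [eΦ' s hs.ne', eΦ'' s hs.ne']
    set A := S' ((Real.log s - t₀) / Λ)
    set B := S'' ((Real.log s - t₀) / Λ)
    have hA : |A| ≤ C := bS' _
    have hB : |B| ≤ C := bS'' _
    have e1 : s * ((1 - γ) / Λ * (A * s⁻¹)) = (1 - γ) * (A / Λ) := by field_simp
    have e2 : s ^ 2 * ((1 - γ) / Λ * (B / Λ - A) / s ^ 2) = (1 - γ) * ((B / Λ - A) / Λ) := by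
      field_simp
    rw [e1, e2, abs_mul, abs_mul, abs_of_pos (by linarith : 0 < 1 - γ), abs_div, abs_div,
      abs_of_pos hΛ0]
    have hBΛ : |B / Λ| ≤ C := by
      rw [abs_div, abs_of_pos hΛ0]
      exact (div_le_self (abs_nonneg _) hΛ1).trans hB
    have hBA : |B / Λ - A| ≤ 2 * C := (abs_sub _ _).trans (by linarith)
    have h3 : |A| / Λ ≤ C / Λ := by gcongr
    have h4 : |B / Λ - A| / Λ ≤ 2 * C / Λ := by gcongr
    have h5 : 11 * (C / Λ) ≤ γ := by
      rw [← mul_div_assoc, div_le_iff₀ hΛ0]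
      exact hΛγ
    have h6 : 2 * C / Λ = 2 * (C / Λ) := by ring
    have h7 : 0 ≤ |A| / Λ := by positivity
    have h8 : 0 ≤ |B / Λ - A| / Λ := by positivity
    nlinarith

lemma IsCutoff.deriv_eq_zero {γ s₀ : ℝ} {Φ Φ' Φ'' : ℝ → ℝ} (hΦ : IsCutoff γ s₀ Φ Φ' Φ'') {s : ℝ}
    (hs : |s| < s₀) : Φ' s = 0 := by
  have h : Φ =ᶠ[nhds s] fun _ => 0 := by
    filter_upwards [(isOpen_lt continuous_abs continuous_const).mem_nhds hs] with y hy
    exact hΦ.eq_zero y (le_of_lt hy)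
  exact (hΦ.hasDerivAt s).unique ((hasDerivAt_const s (0 : ℝ)).congr_of_eventuallyEq h)

/-! ### The truncated product -/

/-- The product `u v`, cut off near the origin. -/
def cutProd (Φ : ℝ → ℝ) (u v : ℝ) : ℝ := u * v * Φ (u ^ 2 + v ^ 2)

/-- The partial derivative of `cutProd` in its first argument. -/
def cutProdDeriv (Φ Φ' : ℝ → ℝ) (u v : ℝ) : ℝ :=
  v * Φ (u ^ 2 + v ^ 2) + 2 * u ^ 2 * v * Φ' (u ^ 2 + v ^ 2)

lemma IsCutoff.hasDerivAt_cutProd {γ s₀ : ℝ} {Φ Φ' Φ'' : ℝ → ℝ} (hΦ : IsCutoff γ s₀ Φ Φ' Φ'')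
    (u v : ℝ) : HasFDerivAt (fun p : ℝ × ℝ => cutProd Φ p.1 p.2)
      (cutProdDeriv Φ Φ' u v • ContinuousLinearMap.fst ℝ ℝ ℝ +
        cutProdDeriv Φ Φ' v u • ContinuousLinearMap.snd ℝ ℝ ℝ) (u, v) := by
  have h1 : HasFDerivAt (fun p : ℝ × ℝ => p.1) (ContinuousLinearMap.fst ℝ ℝ ℝ) (u, v) :=
    hasFDerivAt_fst
  have h2 : HasFDerivAt (fun p : ℝ × ℝ => p.2) (ContinuousLinearMap.snd ℝ ℝ ℝ) (u, v) :=
    hasFDerivAt_snd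
  have h3 := (hΦ.hasDerivAt (u ^ 2 + v ^ 2)).comp_hasFDerivAt (u, v) ((h1.pow 2).add (h2.pow 2))
  have h4 := (h1.mul h2).mul h3
  refine h4.congr_fderiv ?_
  ext <;> simp [cutProdDeriv] <;> ring_nf

/-- The expressions are the pure and the mixed second partial derivatives of `cutProd`; the bounds
follow from `|x y| ≤ s / 2`. The mixed one stays below `1` because `Φ` only reaches `1 - γ`. -/
lemma IsCutoff.second_deriv_bounds {γ s₀ : ℝ} {Φ Φ' Φ'' : ℝ → ℝ} (hΦ : IsCutoff γ s₀ Φ Φ' Φ'')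
    (x y s : ℝ) (hs : s = x ^ 2 + y ^ 2) :
    |6 * x * y * Φ' s + 4 * x ^ 3 * y * Φ'' s| ≤ γ ∧
      -γ ≤ Φ s + 2 * s * Φ' s + 4 * x ^ 2 * y ^ 2 * Φ'' s ∧
      Φ s + 2 * s * Φ' s + 4 * x ^ 2 * y ^ 2 * Φ'' s ≤ 1 := by
  have hx : 0 ≤ x ^ 2 := sq_nonneg x
  have hy : 0 ≤ y ^ 2 := sq_nonneg y
  have hs0 : 0 ≤ s := by rw [hs]; positivity
  have hb := hΦ.bound s hs0
  have hxy : |x * y| ≤ s / 2 := by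
    rw [abs_le]
    constructor <;> nlinarith [sq_nonneg (x + y), sq_nonneg (x - y)]
  have h4 : x ^ 2 * |x * y| ≤ s * (s / 2) :=
    mul_le_mul (by linarith) hxy (abs_nonneg _) hs0
  have k1 : |6 * x * y * Φ' s| ≤ 3 * |s * Φ' s| := by
    have e : |6 * x * y * Φ' s| = 6 * |x * y| * |Φ' s| := by
      rw [show 6 * x * y * Φ' s = 6 * (x * y) * Φ' s by ring, abs_mul, abs_mul,
        abs_of_pos (by norm_num : (0 : ℝ) < 6)]
    rw [e, abs_mul s, abs_of_nonneg hs0, ← mul_assoc]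
    exact mul_le_mul_of_nonneg_right (by linarith) (abs_nonneg _)
  have k2 : |4 * x ^ 3 * y * Φ'' s| ≤ 4 * |s ^ 2 * Φ'' s| := by
    have e : |4 * x ^ 3 * y * Φ'' s| = 4 * (x ^ 2 * |x * y|) * |Φ'' s| := by
      rw [show 4 * x ^ 3 * y * Φ'' s = 4 * (x ^ 2 * (x * y)) * Φ'' s by ring, abs_mul, abs_mul,
        abs_mul, abs_of_pos (by norm_num : (0 : ℝ) < 4), abs_of_nonneg hx]
    rw [e, abs_mul (s ^ 2), abs_of_nonneg (sq_nonneg s), ← mul_assoc 4 (s ^ 2)]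
    exact mul_le_mul_of_nonneg_right (by linarith [sq_nonneg s]) (abs_nonneg _)
  have k3 : |4 * x ^ 2 * y ^ 2 * Φ'' s| ≤ |s ^ 2 * Φ'' s| := by
    rw [abs_mul, abs_mul (s ^ 2), abs_of_nonneg (sq_nonneg s), abs_of_nonneg (by positivity)]
    refine mul_le_mul_of_nonneg_right ?_ (abs_nonneg _)
    rw [hs]
    nlinarith [sq_nonneg (x ^ 2 - y ^ 2)]
  have n0 := hΦ.nonneg s
  have n1 := abs_le.1 (le_refl |s * Φ' s|)
  have n2 := abs_le.1 (le_refl |4 * x ^ 2 * y ^ 2 * Φ'' s|)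
  have n3 := abs_nonneg (s * Φ' s)
  have n4 := abs_nonneg (s ^ 2 * Φ'' s)
  have n5 := hΦ.le s
  refine ⟨(abs_add_le _ _).trans (by linarith), by linarith [n1.1, n2.1], by linarith [n1.2, n2.2]⟩

/-- Mean value theorem along the segment from `(u, v)` to `(u', v')`: `θ₁`, `θ₂` are the second
partial derivatives at an intermediate point. -/
lemma IsCutoff.cutProdDeriv_sub {γ s₀ : ℝ} {Φ Φ' Φ'' : ℝ → ℝ} (hΦ : IsCutoff γ s₀ Φ Φ' Φ'')
    (u v u' v' : ℝ) : ∃ θ₁ θ₂ : ℝ, |θ₁| ≤ γ ∧ -γ ≤ θ₂ ∧ θ₂ ≤ 1 ∧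
      cutProdDeriv Φ Φ' u' v' - cutProdDeriv Φ Φ' u v = θ₁ * (u' - u) + θ₂ * (v' - v) := by
  set U : ℝ → ℝ := fun t => u + t * (u' - u)
  set V : ℝ → ℝ := fun t => v + t * (v' - v)
  set θ₁ : ℝ → ℝ → ℝ := fun x y =>
    6 * x * y * Φ' (x ^ 2 + y ^ 2) + 4 * x ^ 3 * y * Φ'' (x ^ 2 + y ^ 2)
  set θ₂ : ℝ → ℝ → ℝ := fun x y => Φ (x ^ 2 + y ^ 2) + 2 * (x ^ 2 + y ^ 2) * Φ' (x ^ 2 + y ^ 2) +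
    4 * x ^ 2 * y ^ 2 * Φ'' (x ^ 2 + y ^ 2)
  have hd : ∀ t, HasDerivAt (fun t => cutProdDeriv Φ Φ' (U t) (V t))
      (θ₁ (U t) (V t) * (u' - u) + θ₂ (U t) (V t) * (v' - v)) t := by
    intro t
    have hU : HasDerivAt U (u' - u) t := by
      have h := ((hasDerivAt_id t).mul_const (u' - u)).const_add u
      rw [one_mul] at h
      exact h
    have hV : HasDerivAt V (v' - v) t := by
      have h := ((hasDerivAt_id t).mul_const (v' - v)).const_add v
      rw [one_mul] at h
      exact h
    have hs := (hU.pow 2).add (hV.pow 2)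
    have h1 := (hΦ.hasDerivAt (U t ^ 2 + V t ^ 2)).comp t hs
    have h2 := (hΦ.hasDerivAt' (U t ^ 2 + V t ^ 2)).comp t hs
    have h3 := (hV.mul h1).add ((((hU.pow 2).const_mul 2).mul hV).mul h2)
    refine h3.congr_deriv ?_
    simp only [θ₁, θ₂, Function.comp]
    simp
    ring
  obtain ⟨t, -, ht⟩ := exists_hasDerivAt_eq_slope (fun t => cutProdDeriv Φ Φ' (U t) (V t)) _
    (zero_lt_one) (fun t _ => (hd t).continuousAt.continuousWithinAt) (fun t _ => hd t)
  obtain ⟨b1, b2, b3⟩ := hΦ.second_deriv_bounds (U t) (V t) _ rfl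
  refine ⟨θ₁ (U t) (V t), θ₂ (U t) (V t), b1, b2, b3, ?_⟩
  rw [ht]
  simp [U, V]

/-! ### Smooth functions with antitone gradient -/

lemma convex_cube (n : ℕ) : Convex ℝ (cube n) := by
  intro x hx y hy a b ha hb hab i
  exact (convex_Icc (0 : ℝ) 1) (hx i) (hy i) ha hb hab

lemma uniqueDiffOn_cube (n : ℕ) : UniqueDiffOn ℝ (cube n) := by
  have : cube n = Set.preimage (EuclideanSpace.equiv (Fin n) ℝ)
      (Set.univ.pi fun _ : Fin n => Set.Icc (0 : ℝ) 1) := by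
    ext x
    simp only [cube, Set.mem_ofPred_eq, Set.mem_preimage, Set.mem_univ_pi]
    rfl
  rw [this]
  exact (EuclideanSpace.equiv (Fin n) ℝ).uniqueDiffOn_preimage_iff.2
    (UniqueDiffOn.univ_pi fun _ => uniqueDiffOn_Icc zero_lt_one)

lemma cubeGradient_eq {n : ℕ} {F : Vec n → ℝ} {g x : Vec n} (h : HasGradientAt F g x)
    (hx : x ∈ cube n) : cubeGradient F x = g := by
  rw [cubeGradient, gradientWithin,
    h.hasFDerivAt.hasFDerivWithinAt.fderivWithin (uniqueDiffOn_cube n x hx)]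
  simp

/-- Mean value theorem for `t ↦ F (b + t e) - F (a + t e)`, whose derivative is a difference of
gradient coordinates at ordered points. -/
lemma drSubmodular_of_antitone_gradient {n : ℕ} {F : Vec n → ℝ} {g : Vec n → Vec n}
    (hg : ∀ x, HasGradientAt F (g x) x)
    (hanti : ∀ x ∈ cube n, ∀ y ∈ cube n, (∀ j, x j ≤ y j) → ∀ i, g y i ≤ g x i) :
    DRSubmodular F := by
  intro a ha b hb k hk i hab hbk
  set e : Vec n := EuclideanSpace.single i (1 : ℝ) with he
  have hej : ∀ j, 0 ≤ e j := fun j => by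
    rw [he, PiLp.single_apply]
    split_ifs <;> norm_num
  have hd : ∀ x t, HasDerivAt (fun t : ℝ => F (x + t • e)) (g (x + t • e) i) t := by
    intro x t
    have h1 : HasDerivAt (fun t : ℝ => x + t • e) e t := by
      simpa using ((hasDerivAt_id t).smul_const e).const_add x
    have h2 := (hg (x + t • e)).hasFDerivAt.comp_hasDerivAt t h1
    refine h2.congr_deriv ?_
    simp [he, EuclideanSpace.inner_single_right]
  obtain ⟨t, ht, hslope⟩ := exists_hasDerivAt_eq_slope
    (fun t => F (b + t • e) - F (a + t • e)) _ hk
    (fun t _ => ((hd b t).sub (hd a t)).continuousAt.continuousWithinAt)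
    (fun t _ => (hd b t).sub (hd a t))
  have hmem : ∀ x ∈ cube n, (∀ j, x j ≤ b j) → x + t • e ∈ cube n := by
    intro x hx hxb j
    have h1 := (hx j).1
    have h2 := (hbk j).2
    have h3 := hxb j
    have h4 := hej j
    simp only [PiLp.add_apply, PiLp.smul_apply, smul_eq_mul] at h2 ⊢
    constructor
    · nlinarith [ht.1, mul_nonneg ht.1.le h4]
    · nlinarith [ht.2, mul_le_mul_of_nonneg_right ht.2.le h4]
  have hle := hanti (a + t • e) (hmem a ha hab) (b + t • e) (hmem b hb fun _ => le_rfl)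
    (fun j => by simpa using hab j) i
  have h5 : (F (b + k • e) - F (a + k • e) - (F (b + (0 : ℝ) • e) - F (a + (0 : ℝ) • e))) /
      (k - 0) ≤ 0 := by
    rw [← hslope]
    linarith
  rw [div_nonpos_iff] at h5
  simp only [zero_smul, add_zero, sub_zero] at h5
  rcases h5 with h5 | h5 <;> linarith [h5.1, h5.2]

/-! ### Weight vectors -/

/-- `w` holds the weights of a weighted mean; `p` puts the weight of a fraction `1 / k` on a subset
of the coordinates. -/
structure IsSplit {n : ℕ} (k : ℝ) (w p : Vec n) : Prop where
  nonneg : ∀ i, 0 ≤ w i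
  cases : ∀ i, p i = 0 ∨ p i = k * w i
  sum_w : ∑ i, w i = 1
  sum_p : ∑ i, p i = 1

lemma inner_mono_of_nonneg {n : ℕ} {w x y : Vec n} (hw : ∀ i, 0 ≤ w i) (hxy : ∀ i, x i ≤ y i) :
    inner ℝ w x ≤ inner ℝ w y := by
  simp only [PiLp.inner_apply]
  refine Finset.sum_le_sum fun i _ => ?_
  simp only [inner, RCLike.mul_re]
  simpa using mul_le_mul_of_nonneg_right (hxy i) (hw i)

lemma inner_mem_of_mem_cube {n : ℕ} {w x : Vec n} (hw : ∀ i, 0 ≤ w i) (hx : x ∈ cube n) :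
    0 ≤ inner ℝ w x ∧ inner ℝ w x ≤ ∑ i, w i := by
  constructor
  · have := inner_mono_of_nonneg (x := 0) (y := x) hw fun i => (hx i).1
    simpa using this
  · have := inner_mono_of_nonneg (x := x) (y := WithLp.toLp 2 fun _ => 1) hw fun i => (hx i).2
    refine this.trans (le_of_eq ?_)
    simp [PiLp.inner_apply]

lemma norm_le_one_of_sum_eq_one {n : ℕ} {w : Vec n} (hw : ∀ i, 0 ≤ w i) (h : ∑ i, w i = 1) :
    ‖w‖ ≤ 1 := by
  rw [EuclideanSpace.norm_eq, Real.sqrt_le_iff]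
  refine ⟨zero_le_one, ?_⟩
  rw [one_pow, ← h]
  refine Finset.sum_le_sum fun i _ => ?_
  have hi : w i ≤ 1 := h ▸ Finset.single_le_sum (fun j _ => hw j) (Finset.mem_univ i)
  rw [Real.norm_eq_abs, sq_abs]
  nlinarith [hw i]

namespace IsSplit

variable {n : ℕ} {k : ℝ} {w p : Vec n}

lemma p_nonneg (h : IsSplit k w p) (hk : 0 ≤ k) (i : Fin n) : 0 ≤ p i := by
  rcases h.cases i with h' | h' <;> rw [h']
  exact mul_nonneg hk (h.nonneg i)

lemma p_le (h : IsSplit k w p) (hk : 0 ≤ k) (i : Fin n) : 0 ≤ (k • w - p) i := by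
  have := mul_nonneg hk (h.nonneg i)
  rcases h.cases i with h' | h' <;> simp [h', this]

lemma inner_w_mem (h : IsSplit k w p) {x : Vec n} (hx : x ∈ cube n) :
    0 ≤ inner ℝ w x ∧ inner ℝ w x ≤ 1 := h.sum_w ▸ inner_mem_of_mem_cube h.nonneg hx

lemma inner_p_mem (h : IsSplit k w p) (hk : 0 ≤ k) {x : Vec n} (hx : x ∈ cube n) :
    0 ≤ inner ℝ p x ∧ inner ℝ p x ≤ 1 := h.sum_p ▸ inner_mem_of_mem_cube (h.p_nonneg hk) hx

/-- The vector `k w - p` is the non-negative weight, of total mass `k - 1`, on the coordinates that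
are not hidden. -/
lemma inner_rest_mem (h : IsSplit k w p) (hk : 0 ≤ k) {x : Vec n} (hx : x ∈ cube n) :
    0 ≤ k * inner ℝ w x - inner ℝ p x ∧ k * inner ℝ w x - inner ℝ p x ≤ k - 1 := by
  have := inner_mem_of_mem_cube (h.p_le hk) hx
  simpa [inner_sub_left, real_inner_smul_left, Finset.sum_sub_distrib, ← Finset.mul_sum, h.sum_w,
    h.sum_p] using this

lemma inner_mono (h : IsSplit k w p) (hk : 0 ≤ k) {x y : Vec n} (hxy : ∀ i, x i ≤ y i) :
    inner ℝ p x ≤ inner ℝ p y ∧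
      inner ℝ p y - inner ℝ p x ≤ k * (inner ℝ w y - inner ℝ w x) := by
  refine ⟨inner_mono_of_nonneg (h.p_nonneg hk) hxy, ?_⟩
  have := inner_mono_of_nonneg (h.p_le hk) hxy
  simp only [inner_sub_left, real_inner_smul_left] at this
  linarith

lemma norm_w_le (h : IsSplit k w p) : ‖w‖ ≤ 1 := norm_le_one_of_sum_eq_one h.nonneg h.sum_w

lemma norm_p_le (h : IsSplit k w p) (hk : 0 ≤ k) : ‖p‖ ≤ 1 :=
  norm_le_one_of_sum_eq_one (h.p_nonneg hk) h.sum_p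

end IsSplit

/-! ### The objective -/

/-- The objective. With `ā, b̄` the means of two groups of coordinates and `a, b` the means of hidden
parts of these groups, it is `k ā (1 - b̄)` minus a cut-off covariance term, plus `η` times a concave
term. -/
noncomputable def obj {n : ℕ} (k η : ℝ) (Φ : ℝ → ℝ) (wA wB pA pB : Vec n) (x : Vec n) : ℝ :=
  k * inner ℝ wA x * (1 - inner ℝ wB x)
    - k / (k - 1) * cutProd Φ (inner ℝ (pA - wA) x) (inner ℝ (pB - wB) x)
    + η * (2 * inner ℝ wA x - inner ℝ wA x ^ 2) + η * (2 * inner ℝ wB x - inner ℝ wB x ^ 2)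

/-- The gradient of `obj`. -/
noncomputable def objGrad {n : ℕ} (k η : ℝ) (Φ Φ' : ℝ → ℝ) (wA wB pA pB : Vec n) (x : Vec n) :
    Vec n :=
  (k * (1 - inner ℝ wB x) + 2 * η * (1 - inner ℝ wA x)) • wA
    + (2 * η * (1 - inner ℝ wB x) - k * inner ℝ wA x) • wB
    - (k / (k - 1) * cutProdDeriv Φ Φ' (inner ℝ (pA - wA) x) (inner ℝ (pB - wB) x)) • (pA - wA)
    - (k / (k - 1) * cutProdDeriv Φ Φ' (inner ℝ (pB - wB) x) (inner ℝ (pA - wA) x)) • (pB - wB)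

section Objective

variable {n : ℕ} {k η γ s₀ : ℝ} {Φ Φ' Φ'' : ℝ → ℝ} {wA wB pA pB : Vec n}

lemma contDiff_obj (hΦ : IsCutoff γ s₀ Φ Φ' Φ'') : ContDiff ℝ 1 (obj k η Φ wA wB pA pB) := by
  have h : ContDiff ℝ 1 Φ := hΦ.contDiff.of_le (by norm_num)
  have hin : ∀ w : Vec n, ContDiff ℝ 1 fun x => inner ℝ w x := fun w => (innerSL ℝ w).contDiff
  unfold obj cutProd
  have hA := hin wA
  have hB := hin wB
  have hA' := hin (pA - wA)
  have hB' := hin (pB - wB)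
  fun_prop

lemma hasGradientAt_obj (hΦ : IsCutoff γ s₀ Φ Φ' Φ'') (x : Vec n) :
    HasGradientAt (obj k η Φ wA wB pA pB) (objGrad k η Φ Φ' wA wB pA pB x) x := by
  rw [hasGradientAt_iff_hasFDerivAt]
  have hin : ∀ w : Vec n, HasFDerivAt (fun x => inner ℝ w x) (innerSL ℝ w) x :=
    fun w => (innerSL ℝ w).hasFDerivAt
  have h1 := ((hin wA).const_mul k).mul ((hin wB).const_sub 1)
  have h2 := ((hΦ.hasDerivAt_cutProd (inner ℝ (pA - wA) x) (inner ℝ (pB - wB) x)).comp x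
    ((hin (pA - wA)).prodMk (hin (pB - wB)))).const_mul (k / (k - 1))
  have h3 : ∀ w : Vec n, HasFDerivAt (fun x => η * (2 * inner ℝ w x - inner ℝ w x ^ 2)) _ x :=
    fun w => (((hin w).const_mul 2).sub ((hin w).pow 2)).const_mul η
  refine (((h1.sub h2).add (h3 wA)).add (h3 wB)).congr_fderiv ?_
  ext y
  simp [objGrad, inner_sub_left]
  ring

/-- Since `Φ` takes values in `[0, 1]`, the main term is a convex combination of the versions with
full and with no covariance. The former is a sum of products of non-negative numbers: a hidden part
and a remaining part. -/
lemma obj_nonneg (hΦ : IsCutoff γ s₀ Φ Φ' Φ'') (hγ : 0 ≤ γ) (hk : 2 ≤ k) (hη : 0 ≤ η)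
    (hA : IsSplit k wA pA) (hB : IsSplit k wB pB) {x : Vec n} (hx : x ∈ cube n) :
    0 ≤ obj k η Φ wA wB pA pB x := by
  have hk0 : 0 ≤ k := by linarith
  have hk1 : 0 < k - 1 := by linarith
  obtain ⟨a1, a2⟩ := hA.inner_w_mem hx
  obtain ⟨b1, b2⟩ := hB.inner_w_mem hx
  obtain ⟨a3, a4⟩ := hA.inner_p_mem hk0 hx
  obtain ⟨b3, b4⟩ := hB.inner_p_mem hk0 hx
  obtain ⟨a5, a6⟩ := hA.inner_rest_mem hk0 hx
  obtain ⟨b5, b6⟩ := hB.inner_rest_mem hk0 hx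
  simp only [obj, cutProd, inner_sub_left]
  set a := inner ℝ pA x
  set b := inner ℝ pB x
  set a' := inner ℝ wA x
  set b' := inner ℝ wB x
  set f := Φ ((a - a') ^ 2 + (b - b') ^ 2)
  have f0 : 0 ≤ f := hΦ.nonneg _
  have f1 : f ≤ 1 := (hΦ.le _).trans (by linarith)
  have hfull : 0 ≤ k * a' * (1 - b') - k / (k - 1) * ((a - a') * (b - b')) := by
    have e : k * a' * (1 - b') - k / (k - 1) * ((a - a') * (b - b')) =
        a * (1 - b) + (k * a' - a) * (k - 1 - (k * b' - b)) / (k - 1) := by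
      field_simp
      ring
    rw [e]
    have := div_nonneg (mul_nonneg a5 (by linarith : 0 ≤ k - 1 - (k * b' - b))) hk1.le
    have := mul_nonneg a3 (by linarith : 0 ≤ 1 - b)
    linarith
  have hsym : 0 ≤ k * a' * (1 - b') := by
    have : 0 ≤ 1 - b' := by linarith
    positivity
  have hmix : k * a' * (1 - b') - k / (k - 1) * ((a - a') * (b - b') * f) =
      f * (k * a' * (1 - b') - k / (k - 1) * ((a - a') * (b - b'))) +
        (1 - f) * (k * a' * (1 - b')) := by ring
  have h1 : 0 ≤ 2 * a' - a' ^ 2 := by nlinarith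
  have h2 : 0 ≤ 2 * b' - b' ^ 2 := by nlinarith
  have h3 := mul_nonneg f0 hfull
  have h4 := mul_nonneg (by linarith : 0 ≤ 1 - f) hsym
  have h5 := mul_nonneg hη h1
  have h6 := mul_nonneg hη h2
  rw [hmix]
  linarith

lemma obj_le (hΦ : IsCutoff γ s₀ Φ Φ' Φ'') (hγ : 0 ≤ γ) (hk : 2 ≤ k) (hη : 0 ≤ η)
    (hA : IsSplit k wA pA) (hB : IsSplit k wB pB) {x : Vec n} (hx : x ∈ cube n) :
    obj k η Φ wA wB pA pB x ≤ k + 2 + 2 * η := by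
  have hk0 : 0 ≤ k := by linarith
  have hk1 : 0 < k - 1 := by linarith
  obtain ⟨a1, a2⟩ := hA.inner_w_mem hx
  obtain ⟨b1, b2⟩ := hB.inner_w_mem hx
  obtain ⟨a3, a4⟩ := hA.inner_p_mem hk0 hx
  obtain ⟨b3, b4⟩ := hB.inner_p_mem hk0 hx
  simp only [obj, cutProd, inner_sub_left]
  set a := inner ℝ pA x
  set b := inner ℝ pB x
  set a' := inner ℝ wA x
  set b' := inner ℝ wB x
  set f := Φ ((a - a') ^ 2 + (b - b') ^ 2)
  have f0 : 0 ≤ f := hΦ.nonneg _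
  have f1 : f ≤ 1 := (hΦ.le _).trans (by linarith)
  have h1 : k * a' * (1 - b') ≤ k := by
    have : a' * (1 - b') ≤ 1 := by nlinarith
    nlinarith
  have h2 : -((a - a') * (b - b') * f) ≤ 1 := by
    have h : |(a - a') * (b - b') * f| ≤ 1 := by
      rw [abs_mul, abs_mul]
      exact mul_le_one₀ (mul_le_one₀ (abs_le.2 ⟨by linarith, by linarith⟩) (abs_nonneg _)
        (abs_le.2 ⟨by linarith, by linarith⟩)) (abs_nonneg _) (abs_le.2 ⟨by linarith, by linarith⟩)
    linarith [(abs_le.1 h).1]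
  have hkk : k / (k - 1) ≤ 2 := by rw [div_le_iff₀ hk1]; linarith
  have hkk0 : 0 ≤ k / (k - 1) := by positivity
  have h3 : η * (2 * a' - a' ^ 2) ≤ η * 1 := mul_le_mul_of_nonneg_left (by nlinarith) hη
  have h4 : η * (2 * b' - b' ^ 2) ≤ η * 1 := mul_le_mul_of_nonneg_left (by nlinarith) hη
  nlinarith [mul_le_mul_of_nonneg_left h2 hkk0]

lemma obj_eq_of_near (hΦ : IsCutoff γ s₀ Φ Φ' Φ'') {x : Vec n}
    (hx : inner ℝ (pA - wA) x ^ 2 + inner ℝ (pB - wB) x ^ 2 < s₀) :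
    obj k η Φ wA wB pA pB x = obj k η 0 wA wB 0 0 x := by
  have h : Φ (inner ℝ (pA - wA) x ^ 2 + inner ℝ (pB - wB) x ^ 2) = 0 :=
    hΦ.eq_zero _ (by rw [abs_of_nonneg (by positivity)]; exact hx.le)
  simp [obj, cutProd, h]

lemma objGrad_eq_of_near (hΦ : IsCutoff γ s₀ Φ Φ' Φ'') {x : Vec n}
    (hx : inner ℝ (pA - wA) x ^ 2 + inner ℝ (pB - wB) x ^ 2 < s₀) :
    objGrad k η Φ Φ' wA wB pA pB x = objGrad k η 0 0 wA wB 0 0 x := by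
  have h : Φ (inner ℝ (pA - wA) x ^ 2 + inner ℝ (pB - wB) x ^ 2) = 0 :=
    hΦ.eq_zero _ (by rw [abs_of_nonneg (by positivity)]; exact hx.le)
  have h' : Φ' (inner ℝ (pA - wA) x ^ 2 + inner ℝ (pB - wB) x ^ 2) = 0 :=
    hΦ.deriv_eq_zero (by rw [abs_of_nonneg (by positivity)]; exact hx)
  have e := add_comm (inner ℝ (pA - wA) x ^ 2) (inner ℝ (pB - wB) x ^ 2)
  simp only [objGrad, cutProdDeriv, ← e, h, h']
  simp

/-! ### Monotonicity and Lipschitz continuity of the gradient -/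

/-- The change of a coordinate of the gradient is nonpositive along increasing directions. -/
lemma gradient_change_nonpos {dA dB da db θ₁ θ₂ : ℝ} (hk : 2 ≤ k) (hγ : γ * (k - 1) ≤ 1)
    (hη : k * (γ * (k - 1)) ≤ 2 * η) (ha0 : 0 ≤ da) (ha1 : da ≤ k * dA)
    (hb0 : 0 ≤ db) (hb1 : db ≤ k * dB) (h₁ : |θ₁| ≤ γ) (h₂ : -γ ≤ θ₂) (h₂' : θ₂ ≤ 1) :
    -k * dB - 2 * η * dA - k * (θ₁ * (da - dA) + θ₂ * (db - dB)) ≤ 0 ∧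
    -k * dB - 2 * η * dA + k / (k - 1) * (θ₁ * (da - dA) + θ₂ * (db - dB)) ≤ 0 := by
  have hk1 : 0 < k - 1 := by linarith
  have hγ0 : 0 ≤ γ := (abs_nonneg _).trans h₁
  have hdA : 0 ≤ dA := by nlinarith
  have hdB : 0 ≤ dB := by nlinarith
  have hγ1 : γ ≤ 1 := by nlinarith
  have hη0 : 0 ≤ η := by nlinarith [mul_nonneg hγ0 hk1.le]
  -- The pure second derivative acts within one row, where the bilinear term `kā (1 - b̄)` offers
  -- nothing to compensate it; the concave term `-2 η dA` does.
  have hu : |θ₁ * (da - dA)| ≤ γ * ((k - 1) * dA) := by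
    rw [abs_mul]
    exact mul_le_mul h₁ (abs_le.2 ⟨by nlinarith, by nlinarith⟩) (abs_nonneg _) hγ0
  obtain ⟨u1, u2⟩ := abs_le.1 hu
  have hkη : k * (γ * ((k - 1) * dA)) ≤ 2 * η * dA := by
    have := mul_le_mul_of_nonneg_right hη hdA
    linarith
  -- Hidden coordinates: `-dB ≤ db - dB ≤ (k - 1) dB`, so `θ₂ ≤ 1` suffices for positive `θ₂` and `γ
  -- (k - 1) ≤ 1` for negative `θ₂`.
  have v1 : -(θ₂ * (db - dB)) ≤ dB := by
    rcases le_total 0 θ₂ with h | h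
    · nlinarith [mul_nonneg h hb0]
    · have : -θ₂ * (db - dB) ≤ -θ₂ * ((k - 1) * dB) :=
        mul_le_mul_of_nonneg_left (by linarith) (by linarith)
      have : -θ₂ * ((k - 1) * dB) ≤ γ * ((k - 1) * dB) :=
        mul_le_mul_of_nonneg_right (by linarith) (by positivity)
      have := mul_le_mul_of_nonneg_right hγ hdB
      linarith
  -- Other coordinates: the prefactor `k / (k - 1)` turns this bound into exactly the available `k
  -- dB`.
  have v2 : θ₂ * (db - dB) ≤ (k - 1) * dB := by
    rcases le_total 0 θ₂ with h | h
    · have : θ₂ * (db - dB) ≤ θ₂ * ((k - 1) * dB) :=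
        mul_le_mul_of_nonneg_left (by linarith) h
      have : θ₂ * ((k - 1) * dB) ≤ 1 * ((k - 1) * dB) :=
        mul_le_mul_of_nonneg_right h₂' (by positivity)
      linarith
    · nlinarith [mul_nonneg (neg_nonneg.2 h) hb0]
  constructor
  · nlinarith
  · have e : k / (k - 1) * (θ₁ * (da - dA) + θ₂ * (db - dB)) ≤
        k / (k - 1) * (γ * ((k - 1) * dA) + (k - 1) * dB) :=
      mul_le_mul_of_nonneg_left (by linarith) (by positivity)
    have e2 : k / (k - 1) * (γ * ((k - 1) * dA) + (k - 1) * dB) = k * (γ * dA) + k * dB := by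
      field_simp
    have e3 : k * (γ * dA) ≤ k * (γ * ((k - 1) * dA)) := by
      refine mul_le_mul_of_nonneg_left (mul_le_mul_of_nonneg_left ?_ hγ0) (by linarith)
      nlinarith
    linarith

/-- Each coordinate carries weight in at most one of the two groups. Within its group `p - w` equals
`(k - 1) w` on hidden coordinates and `-w` on the others, which gives the two inequalities of
`gradient_change_nonpos`. -/
lemma objGrad_antitone (hΦ : IsCutoff γ s₀ Φ Φ' Φ'') (hk : 2 ≤ k) (hγ : γ * (k - 1) ≤ 1)
    (hη : k * (γ * (k - 1)) ≤ 2 * η) (hA : IsSplit k wA pA) (hB : IsSplit k wB pB)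
    (hAB : ∀ i, wA i = 0 ∨ wB i = 0) {x y : Vec n} (hxy : ∀ j, x j ≤ y j) (i : Fin n) :
    objGrad k η Φ Φ' wA wB pA pB y i ≤ objGrad k η Φ Φ' wA wB pA pB x i := by
  have hk0 : 0 ≤ k := by linarith
  have hk1 : k - 1 ≠ 0 := by linarith
  obtain ⟨a1, a2⟩ := hA.inner_mono hk0 hxy
  obtain ⟨b1, b2⟩ := hB.inner_mono hk0 hxy
  have zero : ∀ {w p : Vec n}, IsSplit k w p → w i = 0 → p i = 0 := fun h h0 => by
    rcases h.cases i with h' | h' <;> simp [h', h0]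
  simp only [objGrad, inner_sub_left, PiLp.add_apply, PiLp.sub_apply, PiLp.smul_apply, smul_eq_mul]
  rcases hAB i with h0 | h0
  · rw [h0, zero hA h0]
    obtain ⟨θ₁, θ₂, t1, t2, t3, t⟩ := hΦ.cutProdDeriv_sub (inner ℝ pB x - inner ℝ wB x)
      (inner ℝ pA x - inner ℝ wA x) (inner ℝ pB y - inner ℝ wB y) (inner ℝ pA y - inner ℝ wA y)
    have t' := eq_add_of_sub_eq t
    obtain ⟨c1, c2⟩ := gradient_change_nonpos (η := η) hk hγ hη
      (sub_nonneg.2 b1) b2 (sub_nonneg.2 a1) a2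
      t1 t2 t3
    have hw := hB.nonneg i
    rcases hB.cases i with h | h
    · rw [h, t']
      nlinarith [mul_le_mul_of_nonneg_left c2 hw]
    · rw [h, show k * wB i - wB i = (k - 1) * wB i by ring]
      have e : ∀ d, k / (k - 1) * d * ((k - 1) * wB i) = k * d * wB i := fun d => by field_simp
      rw [e, e, t']
      nlinarith [mul_le_mul_of_nonneg_left c1 hw]
  · rw [h0, zero hB h0]
    obtain ⟨θ₁, θ₂, t1, t2, t3, t⟩ := hΦ.cutProdDeriv_sub (inner ℝ pA x - inner ℝ wA x)
      (inner ℝ pB x - inner ℝ wB x) (inner ℝ pA y - inner ℝ wA y) (inner ℝ pB y - inner ℝ wB y)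
    have t' := eq_add_of_sub_eq t
    obtain ⟨c1, c2⟩ := gradient_change_nonpos (η := η) hk hγ hη
      (sub_nonneg.2 a1) a2 (sub_nonneg.2 b1) b2
      t1 t2 t3
    have hw := hA.nonneg i
    rcases hA.cases i with h | h
    · rw [h, t']
      nlinarith [mul_le_mul_of_nonneg_left c2 hw]
    · rw [h, show k * wA i - wA i = (k - 1) * wA i by ring]
      have e : ∀ d, k / (k - 1) * d * ((k - 1) * wA i) = k * d * wA i := fun d => by field_simp
      rw [e, e, t']
      nlinarith [mul_le_mul_of_nonneg_left c1 hw]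

/-- The constant does not involve the dimension: weight vectors with sum `1` have norm at most `1`.
The two bilinear and concave coefficients contribute `k + 2 η` each, the two cutoff coefficients `8
· 2` each. -/
lemma objGrad_lipschitz (hΦ : IsCutoff γ s₀ Φ Φ' Φ'') (hk : 2 ≤ k) (hγ : γ ≤ 1) (hη : 0 ≤ η)
    (hA : IsSplit k wA pA) (hB : IsSplit k wB pB) (x y : Vec n) :
    ‖objGrad k η Φ Φ' wA wB pA pB x - objGrad k η Φ Φ' wA wB pA pB y‖ ≤
      (2 * k + 4 * η + 32) * ‖x - y‖ := by
  have hk0 : 0 ≤ k := by linarith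
  have hk1 : 0 < k - 1 := by linarith
  have hkk : k / (k - 1) ≤ 2 := by rw [div_le_iff₀ hk1]; linarith
  have hkk0 : 0 ≤ k / (k - 1) := by positivity
  set d := ‖x - y‖
  have hd : 0 ≤ d := norm_nonneg _
  have inner_le : ∀ (w : Vec n) (r : ℝ), ‖w‖ ≤ r → |inner ℝ w x - inner ℝ w y| ≤ r * d := by
    intro w r hw
    rw [← inner_sub_right]
    exact (abs_real_inner_le_norm _ _).trans (mul_le_mul_of_nonneg_right hw hd)
  have nA : ‖pA - wA‖ ≤ 2 := (norm_sub_le _ _).trans (by linarith [hA.norm_w_le, hA.norm_p_le hk0])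
  have nB : ‖pB - wB‖ ≤ 2 := (norm_sub_le _ _).trans (by linarith [hB.norm_w_le, hB.norm_p_le hk0])
  have smul_le : ∀ (c r R : ℝ) (w : Vec n), |c| ≤ r → ‖w‖ ≤ R → ‖c • w‖ ≤ r * R := by
    intro c r R w hc hw
    rw [norm_smul]
    exact mul_le_mul hc hw (norm_nonneg _) ((abs_nonneg _).trans hc)
  have a1 := inner_le wA 1 hA.norm_w_le
  have b1 := inner_le wB 1 hB.norm_w_le
  have a2 := inner_le (pA - wA) 2 nA
  have b2 := inner_le (pB - wB) 2 nB
  have hdp : ∀ u v u' v' : ℝ, |u' - u| ≤ 2 * d → |v' - v| ≤ 2 * d →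
      |k / (k - 1) * (cutProdDeriv Φ Φ' u' v' - cutProdDeriv Φ Φ' u v)| ≤ 8 * d := by
    intro u v u' v' hu hv
    obtain ⟨θ₁, θ₂, t1, t2, t3, t⟩ := hΦ.cutProdDeriv_sub u v u' v'
    have h1 : |θ₁ * (u' - u)| ≤ 1 * (2 * d) := by
      rw [abs_mul]
      exact mul_le_mul (t1.trans hγ) hu (abs_nonneg _) zero_le_one
    have h2 : |θ₂ * (v' - v)| ≤ 1 * (2 * d) := by
      rw [abs_mul]
      exact mul_le_mul (abs_le.2 ⟨by linarith, t3⟩) hv (abs_nonneg _) zero_le_one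
    rw [t, abs_mul, abs_of_nonneg hkk0]
    calc k / (k - 1) * |θ₁ * (u' - u) + θ₂ * (v' - v)| ≤ 2 * (4 * d) :=
          mul_le_mul hkk ((abs_add_le _ _).trans (by linarith)) (abs_nonneg _) zero_le_two
      _ = 8 * d := by ring
  have e : objGrad k η Φ Φ' wA wB pA pB x - objGrad k η Φ Φ' wA wB pA pB y =
      (-k * (inner ℝ wB x - inner ℝ wB y) - 2 * η * (inner ℝ wA x - inner ℝ wA y)) • wA
      + (-(2 * η) * (inner ℝ wB x - inner ℝ wB y) - k * (inner ℝ wA x - inner ℝ wA y)) • wB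
      - (k / (k - 1) * (cutProdDeriv Φ Φ' (inner ℝ (pA - wA) x) (inner ℝ (pB - wB) x) -
          cutProdDeriv Φ Φ' (inner ℝ (pA - wA) y) (inner ℝ (pB - wB) y))) • (pA - wA)
      - (k / (k - 1) * (cutProdDeriv Φ Φ' (inner ℝ (pB - wB) x) (inner ℝ (pA - wA) x) -
          cutProdDeriv Φ Φ' (inner ℝ (pB - wB) y) (inner ℝ (pA - wA) y))) • (pB - wB) := by
    simp only [objGrad]
    module
  have c1 : |-k * (inner ℝ wB x - inner ℝ wB y) - 2 * η * (inner ℝ wA x - inner ℝ wA y)| ≤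
      (k + 2 * η) * d := by
    refine (abs_sub _ _).trans ?_
    rw [abs_mul, abs_mul, abs_neg, abs_of_nonneg hk0, abs_of_nonneg (by positivity : 0 ≤ 2 * η)]
    nlinarith
  have c2 : |-(2 * η) * (inner ℝ wB x - inner ℝ wB y) - k * (inner ℝ wA x - inner ℝ wA y)| ≤
      (k + 2 * η) * d := by
    refine (abs_sub _ _).trans ?_
    rw [abs_mul, abs_mul, abs_neg, abs_of_nonneg hk0,
      abs_of_nonneg (by positivity : 0 ≤ 2 * η)]
    nlinarith
  rw [e]
  refine (norm_sub_le _ _).trans ((add_le_add ((norm_sub_le _ _).trans (add_le_add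
    (norm_add_le _ _) le_rfl)) le_rfl).trans ?_)
  have m1 := smul_le _ _ _ wA c1 hA.norm_w_le
  have m2 := smul_le _ _ _ wB c2 hB.norm_w_le
  have m3 := smul_le _ _ _ (pA - wA) (hdp _ _ _ _ a2 b2) nA
  have m4 := smul_le _ _ _ (pB - wB) (hdp _ _ _ _ b2 a2) nB
  linarith

end Objective

/-! ### A real-RAM program for products of small polytopes -/

/-- The program `p` halts from `σ` within `T` steps in a state satisfying `Q`. -/
def HaltsIn (p : RamProg) (σ : RamState) (T : ℕ) (Q : RamState → Prop) : Prop :=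
  ∃ τ t, Exec p σ τ t ∧ t ≤ T ∧ Q τ

lemma HaltsIn.mono {p : RamProg} {σ : RamState} {T : ℕ} {Q R : RamState → Prop}
    (h : HaltsIn p σ T Q) (hQR : ∀ τ, Q τ → R τ) : HaltsIn p σ T R := by
  obtain ⟨τ, t, h1, h2, h3⟩ := h
  exact ⟨τ, t, h1, h2, hQR τ h3⟩

lemma HaltsIn.mono_time {p : RamProg} {σ : RamState} {T T' : ℕ} {Q : RamState → Prop}
    (h : HaltsIn p σ T Q) (hT : T ≤ T') : HaltsIn p σ T' Q := by
  obtain ⟨τ, t, h1, h2, h3⟩ := h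
  exact ⟨τ, t, h1, h2.trans hT, h3⟩

lemma HaltsIn.seq {p q : RamProg} {σ : RamState} {T U : ℕ} {Q : RamState → Prop}
    (h : HaltsIn p σ T fun τ => HaltsIn q τ U Q) : HaltsIn (.seq p q) σ (T + U) Q := by
  obtain ⟨τ, t, h1, h2, υ, u, h3, h4, h5⟩ := h
  exact ⟨υ, t + u, .seq h1 h3, add_le_add h2 h4, h5⟩

lemma Exec.haltsIn {p : RamProg} {σ τ : RamState} {t : ℕ} {Q : RamState → Prop}
    (h : Exec p σ τ t) (hQ : Q τ) : HaltsIn p σ t Q := ⟨τ, t, h, le_rfl, hQ⟩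

/-- `τ` agrees with `σ` on the registers `0`, `1` and on the cells below the address in
register `0`. -/
structure SameInput (σ τ : RamState) : Prop where
  idx_zero : τ.idx 0 = σ.idx 0
  idx_one : τ.idx 1 = σ.idx 1
  mem : ∀ i < σ.idx 0, τ.mem i = σ.mem i

/-- A linear form in the `d` cells from the address in register `1` on, evaluated into the first
scratch cell. -/
lemma exists_linearForm (v : ℕ → ℝ) (d : ℕ) : ∃ (p : RamProg) (T : ℕ), ∀ σ : RamState,
    σ.idx 1 + d ≤ σ.idx 0 → HaltsIn p σ T fun τ => SameInput σ τ ∧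
      τ.mem (σ.idx 0) = ∑ j ∈ Finset.range d, v j * σ.mem (σ.idx 1 + j) := by
  induction d with
  | zero =>
    refine ⟨.seq (.setIdx 2 0) (.seq (.addIdx 2 2 0) (.setMem 2 0)), 1 + (1 + 1), fun σ _ => ?_⟩
    refine ((Exec.setIdx _ _ _).haltsIn (((Exec.addIdx _ _ _ _).haltsIn
      ((Exec.setMem _ _ _).haltsIn ?_)).seq)).seq
    refine ⟨⟨?_, ?_, fun i hi => ?_⟩, ?_⟩ <;>
      simp [RamState.setIdx, RamState.put, Function.update_apply]
    omega
  | succ d ih =>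
    obtain ⟨p, T, hp⟩ := ih
    -- The sum accumulates in the first cell after the input; the next cell holds the new summand,
    -- so the input is not touched.
    refine ⟨.seq p (.seq (.setIdx 2 0) (.seq (.addIdx 2 2 0) (.seq (.setIdx 3 1)
      (.seq (.addIdx 3 3 0) (.seq (.setIdx 4 d) (.seq (.addIdx 4 4 1) (.seq (.setMem 3 (v d))
        (.seq (.mulMem 3 3 4) (.addMem 2 2 3))))))))),
      T + (1 + (1 + (1 + (1 + (1 + (1 + (1 + (1 + 1)))))))), fun σ hσ => ?_⟩
    refine ((hp σ (by omega)).mono fun τ ⟨⟨h0, h1, hm⟩, hv⟩ => ?_).seq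
    refine ((Exec.setIdx _ _ _).haltsIn (((Exec.addIdx _ _ _ _).haltsIn
      (((Exec.setIdx _ _ _).haltsIn (((Exec.addIdx _ _ _ _).haltsIn
      (((Exec.setIdx _ _ _).haltsIn (((Exec.addIdx _ _ _ _).haltsIn
      (((Exec.setMem _ _ _).haltsIn (((Exec.mulMem _ _ _ _).haltsIn
      ((Exec.addMem _ _ _ _).haltsIn ?_)).seq)).seq)).seq)).seq)).seq)).seq)).seq)).seq
    have e1 : d + σ.idx 1 < σ.idx 0 := by omega
    have e2 : ¬ d + σ.idx 1 = 1 + σ.idx 0 := by omega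
    have e3 : σ.mem (σ.idx 1 + d) = τ.mem (d + σ.idx 1) := by
      rw [hm _ e1, add_comm]
    refine ⟨⟨?_, ?_, fun i hi => ?_⟩, ?_⟩
    · simp [RamState.setIdx, RamState.put, h0]
    · simp [RamState.setIdx, RamState.put, h1]
    · have e4 : i ≠ σ.idx 0 := by omega
      have e5 : i ≠ 1 + σ.idx 0 := by omega
      simp [RamState.setIdx, RamState.put, h0, e4, e5, hm i hi]
    · rw [Finset.sum_range_succ, e3, ← hv]
      simp [RamState.setIdx, RamState.put, RamState.get, h0, h1, e2]

/-- Overwriting the `d` cells from the address in register `1` on. -/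
lemma exists_write (v : ℕ → ℝ) (d : ℕ) : ∃ (p : RamProg) (T : ℕ), ∀ σ : RamState,
    HaltsIn p σ T fun τ => τ.idx 0 = σ.idx 0 ∧ τ.idx 1 = σ.idx 1 ∧
      (∀ j < d, τ.mem (σ.idx 1 + j) = v j) ∧
      ∀ i, i < σ.idx 1 ∨ σ.idx 1 + d ≤ i → τ.mem i = σ.mem i := by
  induction d with
  | zero => exact ⟨.setIdx 2 0, 1, fun σ => (Exec.setIdx _ _ _).haltsIn (by simp [RamState.setIdx])⟩
  | succ d ih =>
    obtain ⟨p, T, hp⟩ := ih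
    refine ⟨.seq p (.seq (.setIdx 2 d) (.seq (.addIdx 2 2 1) (.setMem 2 (v d)))),
      T + (1 + (1 + 1)), fun σ => ?_⟩
    refine ((hp σ).mono fun τ ⟨h0, h1, hw, hm⟩ => ?_).seq
    refine ((Exec.setIdx _ _ _).haltsIn (((Exec.addIdx _ _ _ _).haltsIn
      ((Exec.setMem _ _ _).haltsIn ?_)).seq)).seq
    refine ⟨?_, ?_, fun j hj => ?_, fun i hi => ?_⟩
    · simp [RamState.setIdx, RamState.put, h0]
    · simp [RamState.setIdx, RamState.put, h1]
    · simp only [RamState.setIdx, RamState.put, Function.update_apply]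
      by_cases hjd : j = d
      · subst hjd
        simp [add_comm, h1]
      · have : σ.idx 1 + j ≠ d + σ.idx 1 := by omega
        simp [h1, this, hw j (by omega)]
    · have : i ≠ d + σ.idx 1 := by omega
      simp [RamState.setIdx, RamState.put, h1, this]
      exact hm i (by omega)

/-- Choosing among finitely many vectors one that maximizes a linear form: a decision tree. -/
lemma exists_argmax (d : ℕ) (V : List (ℕ → ℝ)) : ∀ v : ℕ → ℝ, ∃ (p : RamProg) (T : ℕ),
    ∀ σ : RamState, σ.idx 1 + d ≤ σ.idx 0 → HaltsIn p σ T fun τ =>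
      τ.idx 0 = σ.idx 0 ∧ τ.idx 1 = σ.idx 1 ∧
      (∃ w ∈ v :: V, (∀ w' ∈ v :: V, ∑ j ∈ Finset.range d, w' j * σ.mem (σ.idx 1 + j) ≤
          ∑ j ∈ Finset.range d, w j * σ.mem (σ.idx 1 + j)) ∧
        ∀ j < d, τ.mem (σ.idx 1 + j) = w j) ∧
      ∀ i < σ.idx 0, i < σ.idx 1 ∨ σ.idx 1 + d ≤ i → τ.mem i = σ.mem i := by
  induction V with
  | nil =>
    intro v
    obtain ⟨p, T, hp⟩ := exists_write v d
    refine ⟨p, T, fun σ _ => (hp σ).mono fun τ ⟨h0, h1, hw, hm⟩ =>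
      ⟨h0, h1, ⟨v, by simp, by simp, hw⟩, fun i _ hi => hm i hi⟩⟩
  | cons v' V ih =>
    intro v
    -- A knockout comparison: the sign of the form with coefficients `v' - v` eliminates one of the
    -- two vectors, and the branch continues with the other. Cells of the block are overwritten only
    -- at the leaves, after all comparisons.
    obtain ⟨p, T, hp⟩ := ih v
    obtain ⟨p', T', hp'⟩ := ih v'
    obtain ⟨q, S, hq⟩ := exists_linearForm (fun j => v' j - v j) d
    refine ⟨.seq q (.seq (.setIdx 2 0) (.seq (.addIdx 2 2 0) (.seq (.setIdx 3 1)
      (.seq (.addIdx 3 3 0) (.seq (.setMem 3 0) (.iteMem 2 3 p p')))))),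
      S + (1 + (1 + (1 + (1 + (1 + (T + T' + 1)))))), fun σ hσ => ?_⟩
    refine ((hq σ hσ).mono fun τ ⟨⟨h0, h1, hm⟩, hv⟩ => ?_).seq
    refine HaltsIn.seq ((Exec.setIdx _ _ _).haltsIn ?_)
    refine HaltsIn.seq ((Exec.addIdx _ _ _ _).haltsIn ?_)
    refine HaltsIn.seq ((Exec.setIdx _ _ _).haltsIn ?_)
    refine HaltsIn.seq ((Exec.addIdx _ _ _ _).haltsIn ?_)
    refine HaltsIn.seq ((Exec.setMem _ _ _).haltsIn ?_)
    generalize hυ : RamState.put _ 3 (0 : ℝ) = υ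
    have u0 : υ.idx 0 = σ.idx 0 := by
      rw [← hυ]; simp [RamState.setIdx, RamState.put, h0]
    have u1 : υ.idx 1 = σ.idx 1 := by
      rw [← hυ]; simp [RamState.setIdx, RamState.put, h1]
    have u2 : υ.get 2 = ∑ j ∈ Finset.range d, (v' j - v j) * σ.mem (σ.idx 1 + j) := by
      rw [← hυ, ← hv]
      simp [RamState.setIdx, RamState.put, RamState.get, h0]
    have u3 : υ.get 3 = 0 := by
      rw [← hυ]
      simp [RamState.setIdx, RamState.put, RamState.get]
    have um : ∀ i < σ.idx 0, υ.mem i = σ.mem i := by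
      intro i hi
      have e5 : i ≠ 1 + σ.idx 0 := by omega
      rw [← hυ, ← hm i hi]
      simp [RamState.setIdx, RamState.put, h0, e5]
    have usum : ∀ w : ℕ → ℝ, ∑ j ∈ Finset.range d, w j * υ.mem (υ.idx 1 + j) =
        ∑ j ∈ Finset.range d, w j * σ.mem (σ.idx 1 + j) := by
      intro w
      refine Finset.sum_congr rfl fun j hj => ?_
      rw [u1, um _ (by have := Finset.mem_range.1 hj; omega)]
    have hdiff : υ.get 2 = ∑ j ∈ Finset.range d, v' j * σ.mem (σ.idx 1 + j) -
        ∑ j ∈ Finset.range d, v j * σ.mem (σ.idx 1 + j) := by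
      rw [u2, ← Finset.sum_sub_distrib]
      exact Finset.sum_congr rfl fun j _ => by ring
    by_cases hle : υ.get 2 ≤ υ.get 3
    · obtain ⟨ρ, t, hE, ht, r0, r1, ⟨w, hw, hmax, hwr⟩, hr⟩ := hp υ (by omega)
      refine ⟨ρ, t + 1, .iteMem_true hle hE, by omega, by omega, by omega,
        ⟨w, ?_, ?_, fun j hj => by rw [← hwr j hj, u1]⟩, fun i hi hi' => ?_⟩
      · simp only [List.mem_cons] at hw ⊢
        tauto
      · simp only [usum] at hmax
        intro w' hw'
        have hv0 := hmax v (by simp)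
        simp only [List.mem_cons] at hw' hmax
        rcases hw' with rfl | rfl | hw'
        · exact hv0
        · rw [hdiff, u3] at hle
          linarith
        · exact hmax w' (Or.inr hw')
      · rw [hr i (by omega) (by omega), um i hi]
    · obtain ⟨ρ, t, hE, ht, r0, r1, ⟨w, hw, hmax, hwr⟩, hr⟩ := hp' υ (by omega)
      refine ⟨ρ, t + 1, .iteMem_false hle hE, by omega, by omega, by omega,
        ⟨w, ?_, ?_, fun j hj => by rw [← hwr j hj, u1]⟩, fun i hi hi' => ?_⟩
      · simp only [List.mem_cons] at hw ⊢
        tauto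
      · simp only [usum] at hmax
        intro w' hw'
        have hv0 := hmax v' (by simp)
        simp only [List.mem_cons] at hw' hmax
        rcases hw' with rfl | rfl | hw'
        · rw [hdiff, u3] at hle
          linarith
        · exact hv0
        · exact hmax w' (Or.inr hw')
      · rw [hr i (by omega) (by omega), um i hi]

/-- One program that, for every `m`, maximizes a linear form over the `m`-fold product of a fixed
finite set of vectors of length `d`, in time linear in `m`. -/
lemma exists_blockwise_argmax {d : ℕ} (hd : 0 < d) (v : ℕ → ℝ) (V : List (ℕ → ℝ)) :
    ∃ (M : RamProg) (T : ℕ), ∀ (m : ℕ) (σ : RamState), σ.idx 0 = m * d → σ.idx 1 = 0 →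
      HaltsIn M σ (m * T + 1) fun τ => ∀ l < m, ∃ w ∈ v :: V,
        (∀ w' ∈ v :: V, ∑ j ∈ Finset.range d, w' j * σ.mem (l * d + j) ≤
          ∑ j ∈ Finset.range d, w j * σ.mem (l * d + j)) ∧
        ∀ j < d, τ.mem (l * d + j) = w j := by
  obtain ⟨p, T, hp⟩ := exists_argmax d V v
  refine ⟨.whileLt 1 0 (.seq p (.seq (.setIdx 2 d) (.addIdx 1 1 2))), T + 3, ?_⟩
  -- Loop invariant: blocks before `l` hold final answers and are never touched again, while later
  -- blocks still hold the input. Each round costs `T`, two register updates and the loop test; the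
  -- last `1` is the failing test.
  have key : ∀ (r m l : ℕ) (σ : RamState), l + r = m → σ.idx 0 = m * d → σ.idx 1 = l * d →
      HaltsIn (.whileLt 1 0 (.seq p (.seq (.setIdx 2 d) (.addIdx 1 1 2)))) σ (r * (T + 3) + 1)
        fun τ => (∀ i < l * d, τ.mem i = σ.mem i) ∧ ∀ l', l ≤ l' → l' < m → ∃ w ∈ v :: V,
          (∀ w' ∈ v :: V, ∑ j ∈ Finset.range d, w' j * σ.mem (l' * d + j) ≤
            ∑ j ∈ Finset.range d, w j * σ.mem (l' * d + j)) ∧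
          ∀ j < d, τ.mem (l' * d + j) = w j := by
    intro r
    induction r with
    | zero =>
      intro m l σ hlm h0 h1
      refine ((Exec.while_done (by rw [h0, h1]; simp [← hlm])).haltsIn
        ⟨fun i _ => rfl, fun l' hl' hl'' => absurd hl' (by omega)⟩).mono_time (by simp)
    | succ r ih =>
      intro m l σ hlm h0 h1
      have hblock : (l + 1) * d ≤ m * d := Nat.mul_le_mul_right d (by omega)
      have hsucc : (l + 1) * d = l * d + d := by ring
      obtain ⟨τ, t, hE, ht, t0, t1, ⟨w, hw, hmax, hwr⟩, hr⟩ := hp σ (by omega)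
      set τ' := (τ.setIdx 2 d).setIdx 1 ((τ.setIdx 2 d).idx 1 + (τ.setIdx 2 d).idx 2) with hτ'
      have hE' : Exec (.seq p (.seq (.setIdx 2 d) (.addIdx 1 1 2))) σ τ' (t + (1 + 1)) :=
        .seq hE (.seq (.setIdx _ _ _) (.addIdx _ _ _ _))
      have m' : τ'.mem = τ.mem := rfl
      obtain ⟨υ, u, hF, hu, hk, hu'⟩ := ih m (l + 1) τ' (by omega)
        (by rw [← h0, ← t0]; simp [hτ', RamState.setIdx])
        (by simp [hτ', RamState.setIdx]; rw [t1, h1]; ring)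
      refine ⟨υ, t + (1 + 1) + u + 1, .while_loop (by omega) hE' hF, ?_, fun i hi => ?_,
        fun l' hl hl' => ?_⟩
      · rw [Nat.succ_mul]
        omega
      · rw [hk i (by omega), m', hr i (by omega) (by omega)]
      · rcases hl.eq_or_lt with rfl | hl
        · refine ⟨w, hw, ?_, fun j hj => ?_⟩
          · rw [h1] at hmax
            exact hmax
          · rw [hk _ (by omega), m', ← hwr j hj, h1]
        · obtain ⟨w, hw, hmax, hwr⟩ := hu' l' hl hl'
          refine ⟨w, hw, ?_, hwr⟩
          have e : ∀ w : ℕ → ℝ, ∑ j ∈ Finset.range d, w j * τ'.mem (l' * d + j) =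
              ∑ j ∈ Finset.range d, w j * σ.mem (l' * d + j) := by
            intro w
            refine Finset.sum_congr rfl fun j hj => ?_
            have h3 : (l + 1) * d ≤ l' * d := Nat.mul_le_mul_right d hl
            have h4 : (l' + 1) * d ≤ m * d := Nat.mul_le_mul_right d hl'
            have h5 : (l' + 1) * d = l' * d + d := by ring
            have h6 := Finset.mem_range.1 hj
            rw [m', hr _ (by omega) (by omega)]
          simpa only [e] using hmax
  intro m σ h0 h1
  exact (key m m 0 σ (by omega) h0 (by omega)).mono fun τ hτ l hl => hτ.2 l (Nat.zero_le _) hl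

/-! ### The constraint polytope -/

section Instance

variable {m k : ℕ}

/-- Coordinates come in `m` blocks; each block has two rows of `k` coordinates. -/
def coord (m k : ℕ) : Fin m × (Fin 2 × Fin k) ≃ Fin (m * (2 * k)) :=
  (Equiv.prodCongr (Equiv.refl _) finProdFinEquiv).trans finProdFinEquiv

lemma coord_val (l : Fin m) (z : Fin 2 × Fin k) :
    (coord m k (l, z) : ℕ) = l * (2 * k) + finProdFinEquiv z := by
  simp only [coord, Equiv.trans_apply, Equiv.prodCongr_apply, Prod.map, Equiv.refl_apply]
  rw [finProdFinEquiv_apply_val]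
  ring

lemma sum_coord (f : Fin (m * (2 * k)) → ℝ) :
    ∑ i, f i = ∑ l, ∑ z, f (coord m k (l, z)) := by
  rw [← (coord m k).sum_comp, Fintype.sum_prod_type]

lemma inner_coord (x y : Vec (m * (2 * k))) :
    inner ℝ x y = ∑ l, ∑ z, x (coord m k (l, z)) * y (coord m k (l, z)) := by
  rw [← sum_coord (fun i => x i * y i), PiLp.inner_apply]
  exact Finset.sum_congr rfl fun i _ => by simp [mul_comm]

/-- The weights of the mean over row `c` of all blocks. -/
noncomputable def rowWeight (m k : ℕ) (c : Fin 2) : Vec (m * (2 * k)) :=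
  WithLp.toLp 2 fun i => if ((coord m k).symm i).2.1 = c then 1 / ((k : ℝ) * m) else 0

/-- The weights of the mean over the hidden part of row `c`: one coordinate, given by `σ`, in
each block. -/
noncomputable def hiddenWeight (c : Fin 2) (σ : Fin m → Fin k) : Vec (m * (2 * k)) :=
  WithLp.toLp 2 fun i => if ((coord m k).symm i).2.1 = c ∧
    ((coord m k).symm i).2.2 = σ ((coord m k).symm i).1 then 1 / (m : ℝ) else 0

lemma rowWeight_coord (c : Fin 2) (l : Fin m) (z : Fin 2 × Fin k) :
    rowWeight m k c (coord m k (l, z)) = if z.1 = c then 1 / ((k : ℝ) * m) else 0 := by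
  simp [rowWeight]

lemma hiddenWeight_coord (c : Fin 2) (σ : Fin m → Fin k) (l : Fin m) (z : Fin 2 × Fin k) :
    hiddenWeight c σ (coord m k (l, z)) = if z.1 = c ∧ z.2 = σ l then 1 / (m : ℝ) else 0 := by
  simp [hiddenWeight]

lemma inner_rowWeight (c : Fin 2) (x : Vec (m * (2 * k))) :
    inner ℝ (rowWeight m k c) x = (∑ l, ∑ j, x (coord m k (l, (c, j)))) / ((k : ℝ) * m) := by
  rw [inner_coord, Finset.sum_div]
  refine Finset.sum_congr rfl fun l _ => ?_
  rw [Fintype.sum_prod_type, Finset.sum_div, Finset.sum_eq_single c]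
  · refine Finset.sum_congr rfl fun j _ => ?_
    rw [rowWeight_coord, if_pos rfl]
    ring
  · intro c' _ hc
    simp [rowWeight_coord, hc]
  · simp

lemma inner_hiddenWeight (c : Fin 2) (σ : Fin m → Fin k) (x : Vec (m * (2 * k))) :
    inner ℝ (hiddenWeight c σ) x = (∑ l, x (coord m k (l, (c, σ l)))) / (m : ℝ) := by
  rw [inner_coord, Finset.sum_div]
  refine Finset.sum_congr rfl fun l _ => ?_
  rw [Finset.sum_eq_single (c, σ l)]
  · rw [hiddenWeight_coord, if_pos ⟨rfl, rfl⟩]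
    ring
  · rintro ⟨c', j⟩ _ hc
    rw [hiddenWeight_coord, if_neg, zero_mul]
    rintro ⟨rfl, rfl⟩
    exact hc rfl
  · simp

lemma sum_eq_inner_one (w : Vec (m * (2 * k))) :
    ∑ i, w i = inner ℝ w (WithLp.toLp 2 fun _ => (1 : ℝ)) := by
  simp [PiLp.inner_apply]

lemma isSplit_weights (hm : 0 < m) (hk : 0 < k) (c : Fin 2) (σ : Fin m → Fin k) :
    IsSplit (k : ℝ) (rowWeight m k c) (hiddenWeight c σ) := by
  have hm' : (m : ℝ) ≠ 0 := by positivity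
  have hk' : (k : ℝ) ≠ 0 := by positivity
  refine ⟨fun i => ?_, fun i => ?_, ?_, ?_⟩
  · obtain ⟨⟨l, z⟩, rfl⟩ := (coord m k).surjective i
    rw [rowWeight_coord]
    split_ifs <;> positivity
  · obtain ⟨⟨l, z⟩, rfl⟩ := (coord m k).surjective i
    rw [rowWeight_coord, hiddenWeight_coord]
    by_cases h : z.1 = c ∧ z.2 = σ l
    · right
      rw [if_pos h, if_pos h.1]
      field_simp
    · left
      rw [if_neg h]
  · rw [sum_eq_inner_one, inner_rowWeight]
    simp
    field_simp
  · rw [sum_eq_inner_one, inner_hiddenWeight]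
    simp [hm.ne']

lemma rowWeight_disjoint (i : Fin (m * (2 * k))) :
    rowWeight m k 0 i = 0 ∨ rowWeight m k 1 i = 0 := by
  obtain ⟨⟨l, z⟩, rfl⟩ := (coord m k).surjective i
  rw [rowWeight_coord, rowWeight_coord]
  by_cases h : z.1 = 0
  · right
    simp [h]
  · left
    simp [h]

/-- The vertices of one block: `(0, h 1)` and `(eⱼ, 1 - eⱼ)`. -/
def blockVertex (h : ℝ) : Option (Fin k) → Fin 2 × Fin k → ℝ
  | none, z => if z.1 = 0 then 0 else h
  | some j, z => if z.1 = 0 then (if z.2 = j then 1 else 0) else (if z.2 = j then 0 else 1)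

/-- The vertices of the constraint polytope: in each block a vertex of that block. -/
def vertex (h : ℝ) (ρ : Fin m → Option (Fin k)) : Vec (m * (2 * k)) :=
  WithLp.toLp 2 fun i => blockVertex h (ρ ((coord m k).symm i).1) ((coord m k).symm i).2

lemma vertex_coord (h : ℝ) (ρ : Fin m → Option (Fin k)) (l : Fin m) (z : Fin 2 × Fin k) :
    vertex h ρ (coord m k (l, z)) = blockVertex h (ρ l) z := by
  simp [vertex]

/-- The constraint polytope, a product of `m` copies of a fixed polytope. -/
def constraintSet (h : ℝ) (m k : ℕ) : Set (Vec (m * (2 * k))) :=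
  convexHull ℝ (Set.range (vertex h : (Fin m → Option (Fin k)) → _))

lemma isPolytope_constraintSet (h : ℝ) : IsPolytope (constraintSet h m k) :=
  ⟨_, Set.finite_range _, rfl⟩

lemma vertex_mem_constraintSet (h : ℝ) (ρ : Fin m → Option (Fin k)) :
    vertex h ρ ∈ constraintSet h m k := subset_convexHull ℝ _ ⟨ρ, rfl⟩

lemma constraintSet_subset_cube {h : ℝ} (h0 : 0 ≤ h) (h1 : h ≤ 1) :
    constraintSet h m k ⊆ cube (m * (2 * k)) := by
  refine convexHull_min ?_ (convex_cube _)
  rintro _ ⟨ρ, rfl⟩ i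
  obtain ⟨⟨l, z⟩, rfl⟩ := (coord m k).surjective i
  rw [vertex_coord]
  rcases ρ l with _ | j <;> simp only [blockVertex] <;> split_ifs <;> simp [h0, h1]

/-- On the polytope the mean of the second row is determined by that of the first. -/
lemma constraintSet_relation {h : ℝ} (hm : 0 < m) (hk : 0 < k) {x : Vec (m * (2 * k))}
    (hx : x ∈ constraintSet h m k) :
    inner ℝ (rowWeight m k 1) x =
        h + k * inner ℝ (rowWeight m k 0) x * (1 - 1 / (k : ℝ) - h) ∧
      0 ≤ k * inner ℝ (rowWeight m k 0) x ∧ k * inner ℝ (rowWeight m k 0) x ≤ 1 := by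
  have hm' : (m : ℝ) ≠ 0 := by positivity
  have hk' : (k : ℝ) ≠ 0 := by positivity
  set S : Set (Vec (m * (2 * k))) := {x | inner ℝ (rowWeight m k 1) x =
        h + k * inner ℝ (rowWeight m k 0) x * (1 - 1 / (k : ℝ) - h) ∧
      0 ≤ k * inner ℝ (rowWeight m k 0) x ∧ k * inner ℝ (rowWeight m k 0) x ≤ 1}
  suffices constraintSet h m k ⊆ S from this hx
  refine convexHull_min ?_ ?_
  · rintro _ ⟨ρ, rfl⟩
    have row : ∀ o : Option (Fin k), ∑ j, blockVertex h o (1, j) =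
        k * (h + (∑ j, blockVertex h o (0, j)) * (1 - 1 / (k : ℝ) - h)) := by
      intro o
      rcases o with _ | j
      · simp [blockVertex]
      · have : ∀ i : Fin k, (if i = j then (0 : ℝ) else 1) = 1 - if i = j then 1 else 0 := by
          intro i
          split_ifs <;> simp
        simp only [blockVertex, one_ne_zero, if_false, if_true, this, Finset.sum_sub_distrib,
          Finset.sum_ite_eq', Finset.mem_univ, Finset.sum_const, Finset.card_univ,
          Fintype.card_fin]
        simp
        field_simp
    have nn : ∀ o : Option (Fin k), 0 ≤ ∑ j, blockVertex h o (0, j) := by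
      intro o
      refine Finset.sum_nonneg fun j _ => ?_
      rcases o with _ | j <;> simp only [blockVertex] <;> split_ifs <;> simp
    have le1 : ∀ o : Option (Fin k), ∑ j, blockVertex h o (0, j) ≤ 1 := by
      intro o
      rcases o with _ | j <;> simp [blockVertex]
    change _ ∧ _ ∧ _
    rw [inner_rowWeight, inner_rowWeight]
    simp only [vertex_coord, row]
    refine ⟨?_, ?_, ?_⟩
    · rw [← Finset.mul_sum, Finset.sum_add_distrib, ← Finset.sum_mul]
      simp
      field_simp
    · have := Finset.sum_nonneg fun l (_ : l ∈ Finset.univ) => nn (ρ l)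
      positivity
    · have hle := Finset.sum_le_sum fun l (_ : l ∈ Finset.univ) => le1 (ρ l)
      simp only [Finset.sum_const, Finset.card_univ, Fintype.card_fin, nsmul_eq_mul,
        mul_one] at hle
      rw [← div_div, ← mul_div_assoc, mul_div_cancel₀ _ hk', div_le_one (by positivity)]
      exact hle
  · rintro x ⟨hx1, hx2, hx3⟩ y ⟨hy1, hy2, hy3⟩ a b ha hb hab
    change _ ∧ _ ∧ _
    simp only [inner_add_right, real_inner_smul_right]
    refine ⟨?_, ?_, ?_⟩
    · rw [hx1, hy1]
      linear_combination h * hab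
    · nlinarith [mul_nonneg ha hx2, mul_nonneg hb hy2]
    · nlinarith [mul_le_mul_of_nonneg_left hx3 ha, mul_le_mul_of_nonneg_left hy3 hb]

/-- The minimum is attained at the vertex with all blocks `(0, h 1)`. Conversely, the sup norm
bounds the mean of the second row, which is at least `h` by `constraintSet_relation` as `1 - 1/k - h
≥ 0`. -/
lemma isLeast_norm_constraintSet {h : ℝ} (hm : 0 < m) (hk : 0 < k) (h0 : 0 ≤ h)
    (h1 : h ≤ 1 - 1 / (k : ℝ)) :
    IsLeast ((fun x : Vec (m * (2 * k)) => ‖WithLp.ofLp x‖) '' constraintSet h m k) h := by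
  constructor
  · refine ⟨vertex h fun _ => none, vertex_mem_constraintSet _ _, ?_⟩
    apply le_antisymm
    · refine (pi_norm_le_iff_of_nonneg h0).2 fun i => ?_
      obtain ⟨⟨l, z⟩, rfl⟩ := (coord m k).surjective i
      rw [vertex_coord]
      simp only [blockVertex]
      split_ifs <;> simp [h0, abs_of_nonneg h0]
    · have := norm_le_pi_norm (WithLp.ofLp (vertex h fun _ : Fin m => (none : Option (Fin k))))
        (coord m k (⟨0, hm⟩, (1, ⟨0, hk⟩)))
      rw [vertex_coord] at this
      simpa [blockVertex, abs_of_nonneg h0] using this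
  · rintro _ ⟨x, hx, rfl⟩
    obtain ⟨e1, e2, -⟩ := constraintSet_relation hm hk hx
    have h2 : h ≤ inner ℝ (rowWeight m k 1) x := by
      rw [e1]
      have : 0 ≤ 1 - 1 / (k : ℝ) - h := by linarith
      nlinarith [mul_nonneg e2 this]
    have hs := isSplit_weights hm hk 1 (fun _ : Fin m => (⟨0, hk⟩ : Fin k))
    refine h2.trans ?_
    have h3 := inner_mono_of_nonneg (x := x) (y := WithLp.toLp 2 fun _ => ‖WithLp.ofLp x‖) hs.nonneg
      fun i => (le_abs_self _).trans (norm_le_pi_norm (WithLp.ofLp x) i)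
    refine h3.trans (le_of_eq ?_)
    simp only [PiLp.inner_apply]
    simp [← Finset.mul_sum, hs.sum_w]

/-- One program maximizes linear functions over all polytopes `constraintSet h m k`. -/
lemma exists_solvesLinear (h : ℝ) (hk : 0 < k) : ∃ (M : RamProg) (T : Polynomial ℕ), ∀ m : ℕ,
    SolvesLinear M (T.eval (m * (2 * k))) (constraintSet h m k) := by
  set vec : Option (Fin k) → ℕ → ℝ := fun o j =>
    if hj : j < 2 * k then blockVertex h o (finProdFinEquiv.symm ⟨j, hj⟩) else 0 with hvec
  have vec_apply : ∀ o (z : Fin 2 × Fin k), vec o (finProdFinEquiv z : ℕ) = blockVertex h o z := by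
    intro o z
    simp only [hvec]
    rw [dif_pos (finProdFinEquiv z).2]
    exact congrArg _ (Equiv.symm_apply_apply _ _)
  obtain ⟨M, T, hM⟩ := exists_blockwise_argmax (d := 2 * k) (by omega) (vec none)
    ((List.finRange k).map fun j => vec (some j))
  have mem_iff : ∀ w, w ∈ vec none :: ((List.finRange k).map fun j => vec (some j)) ↔
      ∃ o, w = vec o := by
    intro w
    simp only [List.mem_cons, List.mem_map, List.mem_finRange, true_and]
    constructor
    · rintro (rfl | ⟨j, rfl⟩)
      exacts [⟨_, rfl⟩, ⟨_, rfl⟩]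
    · rintro ⟨_ | j, rfl⟩
      exacts [Or.inl rfl, Or.inr ⟨j, rfl⟩]
  -- The running time is linear in `m`, and `m` is at most the dimension `m * (2 * k)`.
  refine ⟨M, Polynomial.C T * Polynomial.X + 1, fun m c => ?_⟩
  obtain ⟨τ, t, hE, ht, hτ⟩ := hM m (RamState.init c) (by simp [RamState.init])
    (by simp [RamState.init])
  have hτ' : ∀ l : Fin m, ∃ o, (∀ o', ∑ z, blockVertex h o' z * c (coord m k (l, z)) ≤
      ∑ z, blockVertex h o z * c (coord m k (l, z))) ∧
      ∀ z, τ.mem (coord m k (l, z)) = blockVertex h o z := by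
    intro l
    obtain ⟨w, hw, hmax, hwτ⟩ := hτ l l.2
    obtain ⟨o, rfl⟩ := (mem_iff w).1 hw
    have hsum : ∀ o', ∑ j ∈ Finset.range (2 * k), vec o' j * (RamState.init c).mem (l * (2 * k) + j)
        = ∑ z, blockVertex h o' z * c (coord m k (l, z)) := by
      intro o'
      rw [Finset.sum_range, ← finProdFinEquiv.sum_comp]
      refine Finset.sum_congr rfl fun z _ => ?_
      rw [vec_apply, ← coord_val]
      simp [RamState.init]
    refine ⟨o, fun o' => ?_, fun z => ?_⟩
    · rw [← hsum, ← hsum]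
      exact hmax _ ((mem_iff _).2 ⟨o', rfl⟩)
    · rw [coord_val, hwτ _ (finProdFinEquiv z).2, vec_apply]
  choose ρ hρ using hτ'
  have hout : τ.out (m * (2 * k)) = vertex h ρ := by
    ext i
    obtain ⟨⟨l, z⟩, rfl⟩ := (coord m k).surjective i
    rw [vertex_coord, ← (hρ l).2 z]
    rfl
  refine ⟨τ, t, hE, ?_, ?_, ?_⟩
  · refine ht.trans ?_
    simp only [Polynomial.eval_add, Polynomial.eval_mul, Polynomial.eval_C, Polynomial.eval_X,
      Polynomial.eval_one]
    have : m ≤ m * (2 * k) := Nat.le_mul_of_pos_right m (by omega)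
    have := Nat.mul_le_mul_left T this
    rw [mul_comm m T]
    omega
  · rw [hout]
    exact vertex_mem_constraintSet _ _
  · rw [hout]
    intro y hy
    have hconv : Convex ℝ {y : Vec (m * (2 * k)) | inner ℝ c y ≤ inner ℝ c (vertex h ρ)} :=
      convex_halfSpace_le (innerSL ℝ c).isLinear _
    refine convexHull_min ?_ hconv hy
    rintro _ ⟨ρ', rfl⟩
    change inner ℝ c _ ≤ inner ℝ c _
    rw [inner_coord, inner_coord]
    refine Finset.sum_le_sum fun l _ => ?_
    have := (hρ l).1 (ρ' l)
    simpa only [vertex_coord, mul_comm] using this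

end Instance

/-! ### Concentration for a random choice in each block -/

open Classical in
-- Chernoff's bound for independent uniform choices `σ l`, in counting form. The exponent `t = δ /
-- 2` minimizes `t² - t δ`, and `δ ≤ 2` keeps `|t f| ≤ 1`, where `exp y ≤ 1 + y + y²`.
lemma card_deviation_le {m k : ℕ} {f : Fin m → Fin k → ℝ} (hf : ∀ l j, |f l j| ≤ 1)
    (hsum : ∀ l, ∑ j, f l j = 0) {δ : ℝ} (h0 : 0 ≤ δ) (h2 : δ ≤ 2) :
    ((Finset.univ.filter fun σ : Fin m → Fin k => δ * m ≤ ∑ l, f l (σ l)).card : ℝ) ≤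
      (k : ℝ) ^ m * Real.exp (-(δ ^ 2 / 4 * m)) := by
  set t := δ / 2 with ht
  have step : ∀ l, ∑ j, Real.exp (t * f l j) ≤ k * Real.exp (t ^ 2) := by
    intro l
    have h1 : ∀ j, Real.exp (t * f l j) ≤ 1 + t * f l j + t ^ 2 := by
      intro j
      have ha : |t * f l j| ≤ 1 := by
        rw [abs_mul, abs_of_nonneg (by positivity)]
        exact mul_le_one₀ (by linarith) (abs_nonneg _) (hf l j)
      have hb := (abs_le.1 (Real.abs_exp_sub_one_sub_id_le ha)).2
      have hc : (t * f l j) ^ 2 ≤ t ^ 2 := by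
        rw [mul_pow]
        exact mul_le_of_le_one_right (sq_nonneg t) ((sq_le_one_iff_abs_le_one _).2 (hf l j))
      linarith
    calc ∑ j, Real.exp (t * f l j) ≤ ∑ j, (1 + t * f l j + t ^ 2) :=
          Finset.sum_le_sum fun j _ => h1 j
      _ = k * (t ^ 2 + 1) := by
          simp only [Finset.sum_add_distrib, ← Finset.mul_sum, hsum]
          simp
          ring
      _ ≤ k * Real.exp (t ^ 2) := by
          gcongr
          exact Real.add_one_le_exp _
  have total : ∑ σ : Fin m → Fin k, Real.exp (t * ∑ l, f l (σ l)) ≤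
      (k : ℝ) ^ m * Real.exp (t ^ 2 * m) := by
    calc ∑ σ : Fin m → Fin k, Real.exp (t * ∑ l, f l (σ l))
        = ∑ σ : Fin m → Fin k, ∏ l, Real.exp (t * f l (σ l)) := by
          refine Finset.sum_congr rfl fun σ _ => ?_
          rw [Finset.mul_sum, Real.exp_sum]
      _ = ∏ l, ∑ j, Real.exp (t * f l j) := by
          rw [Fintype.prod_sum fun l j => Real.exp (t * f l j)]
      _ ≤ ∏ _l : Fin m, (k * Real.exp (t ^ 2)) :=
          Finset.prod_le_prod (fun l _ => Finset.sum_nonneg fun j _ => (Real.exp_pos _).le)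
            fun l _ => step l
      _ = (k : ℝ) ^ m * Real.exp (t ^ 2 * m) := by
          rw [Finset.prod_const, Finset.card_univ, Fintype.card_fin, mul_pow, ← Real.exp_nat_mul]
          ring_nf
  have markov : ((Finset.univ.filter fun σ : Fin m → Fin k => δ * m ≤ ∑ l, f l (σ l)).card : ℝ) *
      Real.exp (t * (δ * m)) ≤ ∑ σ : Fin m → Fin k, Real.exp (t * ∑ l, f l (σ l)) := by
    rw [← nsmul_eq_mul]
    refine (Finset.card_nsmul_le_sum _ _ _ fun σ hσ => ?_).trans
      (Finset.sum_le_sum_of_subset_of_nonneg (Finset.filter_subset _ _)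
        fun σ _ _ => (Real.exp_pos _).le)
    rw [Real.exp_le_exp]
    exact mul_le_mul_of_nonneg_left (Finset.mem_filter.1 hσ).2 (by positivity)
  have hle := markov.trans total
  rw [← le_div_iff₀ (Real.exp_pos _), mul_div_assoc, ← Real.exp_sub] at hle
  refine hle.trans (le_of_eq ?_)
  congr 2
  rw [ht]
  ring

/-- The hidden means of `x` are close to the full means. -/
def Near {m k : ℕ} (δ : ℝ) (σ : Fin m → Fin k) (x : Vec (m * (2 * k))) : Prop :=
  ∀ c, |inner ℝ (hiddenWeight c σ - rowWeight m k c) x| < δ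

open Classical in
-- `card_deviation_le` is applied to the deviation of each entry from its row average in the block;
-- the factor `4` counts two rows and two signs.
lemma card_not_near_le {m k : ℕ} (hm : 0 < m) (hk : 0 < k) {δ : ℝ} (h0 : 0 ≤ δ) (h2 : δ ≤ 2)
    {x : Vec (m * (2 * k))} (hx : x ∈ cube (m * (2 * k))) :
    ((Finset.univ.filter fun σ : Fin m → Fin k => ¬ Near δ σ x).card : ℝ) ≤
      4 * ((k : ℝ) ^ m * Real.exp (-(δ ^ 2 / 4 * m))) := by
  have hm' : (0 : ℝ) < m := by positivity
  have hk' : (0 : ℝ) < k := by positivity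
  set f : Fin 2 → Fin m → Fin k → ℝ := fun c l j =>
    x (coord m k (l, (c, j))) - (∑ i, x (coord m k (l, (c, i)))) / k with hf
  have hmean : ∀ c l, 0 ≤ (∑ i, x (coord m k (l, (c, i)))) / (k : ℝ) ∧
      (∑ i, x (coord m k (l, (c, i)))) / (k : ℝ) ≤ 1 := by
    intro c l
    refine ⟨div_nonneg (Finset.sum_nonneg fun i _ => (hx _).1) hk'.le, ?_⟩
    rw [div_le_one hk']
    refine (Finset.sum_le_sum fun i _ => (hx (coord m k (l, (c, i)))).2).trans ?_
    simp
  have hf1 : ∀ c l j, |f c l j| ≤ 1 := by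
    intro c l j
    have h3 := hx (coord m k (l, (c, j)))
    have h4 := hmean c l
    rw [abs_le]
    constructor <;> simp only [hf] <;> linarith [h3.1, h3.2, h4.1, h4.2]
  have hf0 : ∀ c l, ∑ j, f c l j = 0 := by
    intro c l
    simp only [hf, Finset.sum_sub_distrib, Finset.sum_const, Finset.card_univ, Fintype.card_fin,
      nsmul_eq_mul]
    field_simp
    simp
  have hinner : ∀ c σ, inner ℝ (hiddenWeight c σ - rowWeight m k c) x =
      (∑ l, f c l (σ l)) / (m : ℝ) := by
    intro c σ
    rw [inner_sub_left, inner_hiddenWeight, inner_rowWeight]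
    simp only [hf, Finset.sum_sub_distrib, ← Finset.sum_div]
    field_simp
  set S : Fin 2 → Finset (Fin m → Fin k) := fun c =>
    (Finset.univ.filter fun σ : Fin m → Fin k => δ * m ≤ ∑ l, f c l (σ l)) ∪
      (Finset.univ.filter fun σ : Fin m → Fin k => δ * m ≤ ∑ l, -f c l (σ l)) with hS
  set b := (k : ℝ) ^ m * Real.exp (-(δ ^ 2 / 4 * m))
  have hSc : ∀ c, ((S c).card : ℝ) ≤ 2 * b := by
    intro c
    have h3 := card_deviation_le (hf1 c) (hf0 c) h0 h2
    have h4 := card_deviation_le (f := fun l j => -f c l j) (fun l j => by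
      rw [abs_neg]; exact hf1 c l j) (fun l => by simp [hf0 c l]) h0 h2
    have h5 : ((S c).card : ℝ) ≤ _ := Nat.cast_le.2 (Finset.card_union_le _ _)
    push_cast at h5
    linarith
  have hsub : (Finset.univ.filter fun σ : Fin m → Fin k => ¬ Near δ σ x) ⊆ S 0 ∪ S 1 := by
    intro σ hσ
    have h3 := (Finset.mem_filter.1 hσ).2
    simp only [Near, not_forall, not_lt] at h3
    obtain ⟨c, hc⟩ := h3
    have h4 : σ ∈ S c := by
      rw [hinner, abs_div, abs_of_pos hm', le_div_iff₀ hm', le_abs] at hc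
      simp only [hS, Finset.mem_union, Finset.mem_filter, Finset.mem_univ, true_and,
        Finset.sum_neg_distrib]
      exact hc
    rw [Finset.mem_union]
    revert h4
    fin_cases c
    · exact Or.inl
    · exact Or.inr
  have h6 : ((Finset.univ.filter fun σ : Fin m → Fin k => ¬ Near δ σ x).card : ℝ) ≤ _ :=
    Nat.cast_le.2 ((Finset.card_le_card hsub).trans (Finset.card_union_le _ _))
  push_cast at h6
  linarith [hSc 0, hSc 1]

/-! ### Algorithms cannot find the hidden part -/

open Classical in
/-- If every point of the cube distinguishes at most `B` of the objectives from a reference oracle,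
then an algorithm with `q` queries outputs a distinguishing point for at most `(q + 1) B` of them. -/
lemma card_result_not_good_le {n : ℕ} {ι : Type*} [Fintype ι] {F : ι → Vec n → ℝ}
    {good : ι → Vec n → Prop} {val : Vec n → ℝ} {grad : Vec n → Vec n} {B : ℝ}
    (hval : ∀ i, ∀ x ∈ cube n, good i x → F i x = val x)
    (hgrad : ∀ i, ∀ x ∈ cube n, good i x → cubeGradient (F i) x = grad x)
    (hB : ∀ x ∈ cube n, ((Finset.univ.filter fun i => ¬ good i x).card : ℝ) ≤ B) (hB0 : 0 ≤ B)
    (A : QueryAlg n) : ∀ q : ℕ, ((Finset.univ.filter fun i => A.queries (F i) ≤ q ∧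
      A.result (F i) ∈ cube n ∧ ¬ good i (A.result (F i))).card : ℝ) ≤ (q + 1) * B := by
  -- Here `A'` is the continuation of `A` after the reference answer at `x`. Objectives that `x`
  -- does not distinguish follow it with one query less; the at most `B` others are given up.
  have step : ∀ (x : cube n) (A A' : QueryAlg n),
      (∀ i, good i x → A.queries (F i) = A'.queries (F i) + 1 ∧ A.result (F i) = A'.result (F i)) →
      (∀ i, 0 < A.queries (F i)) →
      (∀ q : ℕ, ((Finset.univ.filter fun i => A'.queries (F i) ≤ q ∧
        A'.result (F i) ∈ cube n ∧ ¬ good i (A'.result (F i))).card : ℝ) ≤ (q + 1) * B) →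
      ∀ q : ℕ, ((Finset.univ.filter fun i => A.queries (F i) ≤ q ∧
        A.result (F i) ∈ cube n ∧ ¬ good i (A.result (F i))).card : ℝ) ≤ (q + 1) * B := by
    intro x A A' hAA' hpos ih q
    rcases q with _ | q
    · have : (Finset.univ.filter fun i => A.queries (F i) ≤ 0 ∧
          A.result (F i) ∈ cube n ∧ ¬ good i (A.result (F i))) = ∅ := by
        refine Finset.filter_eq_empty_iff.2 fun i _ hi => ?_
        have := hpos i
        omega
      rw [this]
      simpa using hB0
    · have hsub : (Finset.univ.filter fun i => A.queries (F i) ≤ q + 1 ∧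
          A.result (F i) ∈ cube n ∧ ¬ good i (A.result (F i))) ⊆
          (Finset.univ.filter fun i => A'.queries (F i) ≤ q ∧
            A'.result (F i) ∈ cube n ∧ ¬ good i (A'.result (F i))) ∪
          (Finset.univ.filter fun i => ¬ good i x) := by
        intro i hi
        obtain ⟨h1, h2, h3⟩ := (Finset.mem_filter.1 hi).2
        simp only [Finset.mem_union, Finset.mem_filter, Finset.mem_univ, true_and]
        by_cases hg : good i x
        · obtain ⟨e1, e2⟩ := hAA' i hg
          rw [e2] at h2 h3
          exact Or.inl ⟨by omega, h2, h3⟩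
        · exact Or.inr hg
      have h4 : ((Finset.univ.filter fun i => A.queries (F i) ≤ q + 1 ∧
          A.result (F i) ∈ cube n ∧ ¬ good i (A.result (F i))).card : ℝ) ≤ _ :=
        Nat.cast_le.2 ((Finset.card_le_card hsub).trans (Finset.card_union_le _ _))
      push_cast at h4 ⊢
      linarith [ih q, hB x x.2]
  induction A with
  | output x =>
    intro q
    have hq : (0 : ℝ) ≤ q * B := by positivity
    by_cases hx : x ∈ cube n
    · have h1 : ((Finset.univ.filter fun i => (QueryAlg.output x).queries (F i) ≤ q ∧
          (QueryAlg.output x).result (F i) ∈ cube n ∧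
            ¬ good i ((QueryAlg.output x).result (F i))).card : ℝ) ≤
          (Finset.univ.filter fun i => ¬ good i x).card :=
        Nat.cast_le.2 (Finset.card_le_card fun i hi =>
          Finset.mem_filter.2 ⟨Finset.mem_univ _, (Finset.mem_filter.1 hi).2.2.2⟩)
      linarith [hB x hx]
    · have : (Finset.univ.filter fun i => (QueryAlg.output x).queries (F i) ≤ q ∧
          (QueryAlg.output x).result (F i) ∈ cube n ∧
            ¬ good i ((QueryAlg.output x).result (F i))) = ∅ :=
        Finset.filter_eq_empty_iff.2 fun i _ hi => hx hi.2.1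
      rw [this]
      simp only [Finset.card_empty, Nat.cast_zero]
      linarith
  | value x next ih =>
    refine step x _ (next (val x)) (fun i hi => ?_) (fun i => ?_) (ih _)
    · rw [← hval i x x.2 hi]
      exact ⟨rfl, rfl⟩
    · simp [QueryAlg.queries]
  | gradient x next ih =>
    refine step x _ (next (grad x)) (fun i hi => ?_) (fun i => ?_) (ih _)
    · rw [← hgrad i x x.2 hi]
      exact ⟨rfl, rfl⟩
    · simp [QueryAlg.queries]

/-- The lower integral is superadditive over finite sums, without measurability. -/
lemma sum_lintegral_le {Ω ι : Type*} [MeasurableSpace Ω] (μ : Measure Ω) (s : Finset ι)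
    (f : ι → Ω → ENNReal) : ∑ i ∈ s, ∫⁻ ω, f i ω ∂μ ≤ ∫⁻ ω, ∑ i ∈ s, f i ω ∂μ := by
  classical
  induction s using Finset.induction_on with
  | empty => simp
  | insert a s ha ih =>
    simp only [Finset.sum_insert ha]
    exact (add_le_add le_rfl ih).trans (le_lintegral_add _ _)

/-! ### The hard instances -/

/-- The objective with hidden part `σ`. -/
noncomputable def hiddenObj {m k : ℕ} (η : ℝ) (Φ : ℝ → ℝ) (σ : Fin m → Fin k) :
    Vec (m * (2 * k)) → ℝ :=
  obj k η Φ (rowWeight m k 0) (rowWeight m k 1) (hiddenWeight 0 σ) (hiddenWeight 1 σ)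

section HardInstances

variable {m k : ℕ} {h η γ s₀ δ : ℝ} {Φ Φ' Φ'' : ℝ → ℝ}

lemma Near.sq_add_sq_lt {σ : Fin m → Fin k} {x : Vec (m * (2 * k))} (hx : Near δ σ x)
    (hδ : 2 * δ ^ 2 ≤ s₀) : inner ℝ (hiddenWeight 0 σ - rowWeight m k 0) x ^ 2 +
      inner ℝ (hiddenWeight 1 σ - rowWeight m k 1) x ^ 2 < s₀ := by
  have h0 := sq_lt_sq' (abs_lt.1 (hx 0)).1 (abs_lt.1 (hx 0)).2
  have h1 := sq_lt_sq' (abs_lt.1 (hx 1)).1 (abs_lt.1 (hx 1)).2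
  linarith

/-- With the covariance cut off, only `s (1 - b̄) = (1 - h) s (1 - s) + s²/k` and the concave terms
are left, and `s (1 - s) ≤ 1/4`. -/
lemma hiddenObj_le_of_near (hΦ : IsCutoff γ s₀ Φ Φ' Φ'') (hm : 0 < m) (hk : 0 < k) (hη : 0 ≤ η)
    (h0 : 0 ≤ h) (h1 : h < 1) (hδ : 2 * δ ^ 2 ≤ s₀) {σ : Fin m → Fin k} {x : Vec (m * (2 * k))}
    (hx : x ∈ constraintSet h m k) (hnear : Near δ σ x) :
    hiddenObj η Φ σ x ≤ 1 / 4 * (1 - h) + 1 / k + 2 * η := by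
  have hk' : (0 : ℝ) < k := by positivity
  have hcube := constraintSet_subset_cube h0 h1.le hx
  have hz := hΦ.eq_zero (inner ℝ (hiddenWeight 0 σ - rowWeight m k 0) x ^ 2 +
    inner ℝ (hiddenWeight 1 σ - rowWeight m k 1) x ^ 2)
    (by rw [abs_of_nonneg (by positivity)]; exact (hnear.sq_add_sq_lt hδ).le)
  obtain ⟨e1, e2, e3⟩ := constraintSet_relation hm hk hx
  obtain ⟨a1, a2⟩ := (isSplit_weights hm hk 0 σ).inner_w_mem hcube
  obtain ⟨b1, b2⟩ := (isSplit_weights hm hk 1 σ).inner_w_mem hcube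
  simp only [hiddenObj, obj, cutProd, hz, mul_zero, sub_zero]
  set a := inner ℝ (rowWeight m k 0) x
  set b := inner ℝ (rowWeight m k 1) x
  have h3 : η * (2 * a - a ^ 2) ≤ η * 1 := mul_le_mul_of_nonneg_left (by nlinarith) hη
  have h4 : η * (2 * b - b ^ 2) ≤ η * 1 := mul_le_mul_of_nonneg_left (by nlinarith) hη
  set s := k * a
  have h5 : s * (1 - b) = (1 - h) * (s * (1 - s)) + s ^ 2 * (1 / k) := by
    rw [e1]
    ring
  have h6 : (1 - h) * (s * (1 - s)) ≤ (1 - h) * (1 / 4) :=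
    mul_le_mul_of_nonneg_left (by nlinarith [sq_nonneg (s - 1 / 2)]) (by linarith)
  have h7 : s ^ 2 * (1 / (k : ℝ)) ≤ 1 / k :=
    mul_le_of_le_one_left (by positivity) (by nlinarith)
  linarith

/-- At this vertex `a = 1`, `b = 0`, `ā = 1/k`, `b̄ = 1 - 1/k`. The cutoff sees `2 (1 - 1/k)² ≥
1/2`, so it is at full height, and the main term is `1 - γ + γ/k`. -/
lemma one_sub_le_hiddenObj_vertex (hΦ : IsCutoff γ s₀ Φ Φ' Φ'') (hγ : 0 ≤ γ) (hm : 0 < m)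
    (hk : 2 ≤ k) (hη : 0 ≤ η) (σ : Fin m → Fin k) :
    1 - γ ≤ hiddenObj η Φ σ (vertex h fun l => some (σ l)) := by
  have hk' : (2 : ℝ) ≤ k := by exact_mod_cast hk
  have hk1 : (k : ℝ) - 1 ≠ 0 := by linarith
  have hk0 : (k : ℝ) ≠ 0 := by linarith
  have hm0 : (m : ℝ) ≠ 0 := by positivity
  have ea : inner ℝ (rowWeight m k 0) (vertex h fun l => some (σ l)) = 1 / (k : ℝ) := by
    rw [inner_rowWeight]
    simp only [vertex_coord, blockVertex]
    simp
    field_simp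
  have ea' : inner ℝ (hiddenWeight 0 σ) (vertex h fun l => some (σ l)) = (1 : ℝ) := by
    rw [inner_hiddenWeight]
    simp only [vertex_coord, blockVertex]
    simp [hm.ne']
  have eb : inner ℝ (rowWeight m k 1) (vertex h fun l => some (σ l)) = 1 - 1 / (k : ℝ) := by
    have e := (constraintSet_relation (h := h) hm (by omega)
      (vertex_mem_constraintSet h fun l => some (σ l))).1
    rw [e, ea]
    field_simp
    ring
  have eb' : inner ℝ (hiddenWeight 1 σ) (vertex h fun l => some (σ l)) = (0 : ℝ) := by
    rw [inner_hiddenWeight]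
    simp only [vertex_coord, blockVertex]
    simp
  have hinv : 1 / (k : ℝ) ≤ 1 / 2 := by gcongr
  have hinv0 : 0 ≤ 1 / (k : ℝ) := by positivity
  have htop : Φ ((1 - 1 / (k : ℝ)) ^ 2 + (0 - (1 - 1 / (k : ℝ))) ^ 2) = 1 - γ :=
    hΦ.eq_top _ (by nlinarith)
  simp only [hiddenObj, obj, cutProd, inner_sub_left, ea, ea', eb, eb', htop]
  have e : (k : ℝ) * (1 / k) * (1 - (1 - 1 / k)) -
      k / (k - 1) * ((1 - 1 / k) * (0 - (1 - 1 / k)) * (1 - γ)) = 1 - γ + γ * (1 / k) := by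
    field_simp
    ring
  rw [e]
  have h3 : 0 ≤ η * (2 * (1 / (k : ℝ)) - (1 / (k : ℝ)) ^ 2) := mul_nonneg hη (by nlinarith)
  have h4 : 0 ≤ η * (2 * (1 - 1 / (k : ℝ)) - (1 - 1 / (k : ℝ)) ^ 2) := mul_nonneg hη (by nlinarith)
  have h5 : 0 ≤ γ * (1 / (k : ℝ)) := mul_nonneg hγ hinv0
  linarith

/-- The smoothness bound `β(n) = n` suffices because the Lipschitz constant is fixed while the
dimension grows; `c = 1/2` suffices because the optimum is at least `1 - γ ≥ 1/2`. -/
lemma exists_isInstance {M : RamProg} {T : Polynomial ℕ}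
    (hM : SolvesLinear M (T.eval (m * (2 * k))) (constraintSet h m k))
    (hΦ : IsCutoff γ s₀ Φ Φ' Φ'') (hγ0 : 0 ≤ γ) (hγ1 : γ ≤ 1 / 2) (hm : 0 < m) (hk : 2 ≤ k)
    (hγk : γ * (k - 1) ≤ 1) (hη : k * (γ * (k - 1)) ≤ 2 * η) (h0 : 0 ≤ h)
    (h1 : h ≤ 1 - 1 / (k : ℝ)) (hn : 2 * k + 4 * η + 32 ≤ m * (2 * k)) (σ : Fin m → Fin k) :
    ∃ opt, 1 - γ ≤ opt ∧ IsInstance h (1 / 2) Polynomial.X T M (m * (2 * k))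
      (constraintSet h m k) (hiddenObj η Φ σ) opt := by
  have hk' : (2 : ℝ) ≤ k := by exact_mod_cast hk
  have hk0 : 0 < k := by omega
  have hη0 : 0 ≤ η := by
    have : 0 ≤ (k : ℝ) - 1 := by linarith
    have : 0 ≤ (k : ℝ) * (γ * (k - 1)) := by positivity
    linarith
  have h1' : h ≤ 1 := h1.trans (by have : 0 ≤ 1 / (k : ℝ) := by positivity
                                   linarith)
  have hA := isSplit_weights hm hk0 0 σ
  have hB := isSplit_weights hm hk0 1 σ
  have hcd : ContDiff ℝ 1 (hiddenObj η Φ σ) := contDiff_obj hΦ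
  have hgrad : ∀ x, HasGradientAt (hiddenObj η Φ σ) _ x := fun x => hasGradientAt_obj hΦ x
  have hcompact : IsCompact (constraintSet h m k) := (Set.finite_range _).isCompact_convexHull ℝ
  have hvertex := vertex_mem_constraintSet h fun l => some (σ l)
  obtain ⟨x, hxK, hx⟩ := hcompact.exists_isMaxOn ⟨_, hvertex⟩ hcd.continuous.continuousOn
  have hopt : 1 - γ ≤ hiddenObj η Φ σ x :=
    (one_sub_le_hiddenObj_vertex hΦ hγ0 hm hk hη0 σ).trans (hx hvertex)
  refine ⟨hiddenObj η Φ σ x, hopt, isPolytope_constraintSet h,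
    constraintSet_subset_cube h0 h1', hM, isLeast_norm_constraintSet hm hk0 h0 h1,
    fun y hy => obj_nonneg hΦ hγ0 hk' hη0 hA hB hy, hcd.contDiffOn,
    drSubmodular_of_antitone_gradient hgrad fun x _ y _ hxy i =>
      objGrad_antitone hΦ hk' hγk hη hA hB rowWeight_disjoint hxy i,
    ⟨hcd.contDiffOn, fun x hx y hy => ?_⟩, ⟨⟨x, hxK, rfl⟩, ?_⟩, ?_⟩
  · rw [cubeGradient_eq (hgrad x) hx, cubeGradient_eq (hgrad y) hy]
    refine (objGrad_lipschitz hΦ hk' (by linarith) hη0 hA hB x y).trans ?_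
    refine mul_le_mul_of_nonneg_right ?_ (norm_nonneg _)
    simpa using hn
  · rintro _ ⟨y, hy, rfl⟩
    exact hx hy
  · have hn1 : (1 : ℝ) ≤ ((m * (2 * k) : ℕ) : ℝ) := by
      push_cast
      linarith
    refine (div_le_self (by norm_num) hn1).trans ?_
    linarith

open Classical in
/-- The total value that a deterministic algorithm with `q` queries obtains on the objectives
with all possible hidden parts. -/
lemma sum_hiddenObj_result_le (hΦ : IsCutoff γ s₀ Φ Φ' Φ'') (hγ : 0 ≤ γ) (hm : 0 < m) (hk : 2 ≤ k)
    (hη : 0 ≤ η) (h0 : 0 ≤ h) (h1 : h < 1) (hδ0 : 0 ≤ δ) (hδ2 : δ ≤ 2) (hδ : 2 * δ ^ 2 ≤ s₀)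
    (A : QueryAlg (m * (2 * k))) (q : ℕ)
    (hA : ∀ σ : Fin m → Fin k, A.queries (hiddenObj η Φ σ) ≤ q ∧
      A.result (hiddenObj η Φ σ) ∈ constraintSet h m k) :
    ∑ σ : Fin m → Fin k, hiddenObj η Φ σ (A.result (hiddenObj η Φ σ)) ≤
      (k : ℝ) ^ m * (1 / 4 * (1 - h) + 1 / k + 2 * η +
        (k + 2 + 2 * η) * ((q + 1) * (4 * Real.exp (-(δ ^ 2 / 4 * m))))) := by
  have hk' : (2 : ℝ) ≤ k := by exact_mod_cast hk
  have hk0 : 0 < k := by omega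
  set V := 1 / 4 * (1 - h) + 1 / k + 2 * η with hV
  have hV0 : 0 ≤ V := by
    have : 0 ≤ 1 - h := by linarith
    positivity
  have hcard := card_result_not_good_le (F := fun σ : Fin m → Fin k => hiddenObj η Φ σ)
    (good := fun σ x => Near δ σ x)
    (val := obj k η 0 (rowWeight m k 0) (rowWeight m k 1) 0 0)
    (grad := objGrad k η 0 0 (rowWeight m k 0) (rowWeight m k 1) 0 0)
    (fun σ x _ hx => obj_eq_of_near hΦ (hx.sq_add_sq_lt hδ))
    (fun σ x hx hnear => (cubeGradient_eq (hasGradientAt_obj hΦ x) hx).trans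
      (objGrad_eq_of_near hΦ (hnear.sq_add_sq_lt hδ)))
    (fun x hx => card_not_near_le hm hk0 hδ0 hδ2 hx) (by positivity) A q
  set S := Finset.univ.filter fun σ : Fin m → Fin k => A.queries (hiddenObj η Φ σ) ≤ q ∧
    A.result (hiddenObj η Φ σ) ∈ cube (m * (2 * k)) ∧ ¬ Near δ σ (A.result (hiddenObj η Φ σ))
    with hS
  have hpt : ∀ σ : Fin m → Fin k, hiddenObj η Φ σ (A.result (hiddenObj η Φ σ)) ≤
      V + if σ ∈ S then k + 2 + 2 * η else 0 := by
    intro σ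
    obtain ⟨hq, hK⟩ := hA σ
    have hcube := constraintSet_subset_cube h0 h1.le hK
    by_cases hnear : Near δ σ (A.result (hiddenObj η Φ σ))
    · have h3 := hiddenObj_le_of_near hΦ hm hk0 hη h0 h1 hδ hK hnear
      rw [← hV] at h3
      refine h3.trans (le_add_of_nonneg_right ?_)
      split_ifs <;> positivity
    · rw [if_pos (Finset.mem_filter.2 ⟨Finset.mem_univ _, hq, hcube, hnear⟩)]
      refine (obj_le hΦ hγ hk' hη (isSplit_weights hm hk0 0 σ) (isSplit_weights hm hk0 1 σ)
        hcube).trans ?_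
      linarith
  refine (Finset.sum_le_sum fun σ _ => hpt σ).trans ?_
  rw [Finset.sum_add_distrib, Finset.sum_ite_mem, Finset.univ_inter, Finset.sum_const,
    Finset.sum_const, Finset.card_univ, Fintype.card_fun, Fintype.card_fin, Fintype.card_fin,
    nsmul_eq_mul, nsmul_eq_mul]
  push_cast
  have h5 : 0 ≤ (k : ℝ) + 2 + 2 * η := by positivity
  have h6 := mul_le_mul_of_nonneg_right hcard h5
  nlinarith

end HardInstances

/-! ### Choice of the dimension and of the parameters -/

/-- In large dimension the contribution of the objectives that an algorithm with a sub-exponential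
number of queries can distinguish is negligible. -/
lemma exists_large_dimension {P : ℕ → ℕ} (hP : SubExponential P) {k : ℕ} (hk : 0 < k) {δ ε : ℝ}
    (hδ : 0 < δ) (hε : 0 < ε) (C : ℝ) (N : ℕ) : ∃ m : ℕ, N ≤ m ∧
      C * ((P (m * (2 * k)) + 1) * (4 * Real.exp (-(δ ^ 2 / 4 * m)))) < ε := by
  have hk' : (0 : ℝ) < k := by positivity
  have h1 : Filter.Tendsto (fun m : ℕ => m * (2 * k)) Filter.atTop Filter.atTop :=
    Filter.tendsto_id.atTop_mul_const' (by omega)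
  -- For `n = 2 k m` this rate gives `P(n) ≤ exp(δ² m / 8)`, half of the concentration exponent; the
  -- other half tends to zero.
  have h2 := h1.eventually (hP (δ ^ 2 / (16 * k)) (by positivity))
  have h3 : Filter.Tendsto (fun m : ℕ => |C| * 8 * Real.exp (-(δ ^ 2 / 8 * m))) Filter.atTop
      (nhds (|C| * 8 * 0)) := by
    refine Filter.Tendsto.const_mul _ (Real.tendsto_exp_neg_atTop_nhds_zero.comp ?_)
    exact tendsto_natCast_atTop_atTop.const_mul_atTop (by positivity)
  rw [mul_zero] at h3
  obtain ⟨m, hm2, hm3, hmN⟩ := (h2.and ((h3.eventually (gt_mem_nhds hε)).and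
    (Filter.eventually_ge_atTop N))).exists
  refine ⟨m, hmN, lt_of_le_of_lt ?_ hm3⟩
  set E := Real.exp (-(δ ^ 2 / 8 * m)) with hE
  have hE0 : 0 < E := Real.exp_pos _
  have e1 : Real.exp (-(δ ^ 2 / 4 * m)) = E * E := by
    rw [hE, ← Real.exp_add]
    ring_nf
  have e2 : Real.exp (δ ^ 2 / (16 * k) * ((m * (2 * k) : ℕ) : ℝ)) * E = 1 := by
    rw [hE, ← Real.exp_add, Real.exp_eq_one_iff]
    push_cast
    field_simp
    ring
  have e3 : E ≤ 1 := Real.exp_le_one_iff.2 (by rw [neg_nonpos]; positivity)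
  have h4 : (P (m * (2 * k)) : ℝ) * E ≤ 1 := by
    rw [← e2]
    exact mul_le_mul_of_nonneg_right hm2 hE0.le
  have h5 : ((P (m * (2 * k)) : ℝ) + 1) * (4 * (E * E)) ≤ 8 * E := by nlinarith
  rw [e1, mul_assoc]
  exact mul_le_mul (le_abs_self C) h5 (by positivity) (abs_nonneg _)

/-- The parameters of the construction: the number `k` of coordinates per row of a block, and the
slack `γ`. -/
lemma exists_parameters {h ε : ℝ} (h0 : 0 ≤ h) (h1 : h < 1) (hε : 0 < ε) :
    ∃ (k : ℕ) (γ : ℝ), 2 ≤ k ∧ 0 < γ ∧ γ ≤ 1 / 2 ∧ γ * (k - 1) ≤ 1 ∧ h ≤ 1 - 1 / (k : ℝ) ∧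
      1 / 4 * (1 - h) + 1 / k + 2 * (k ^ 2 * γ) + ε / 2 ≤ (1 / 4 * (1 - h) + ε) * (1 - γ) := by
  -- The three summands ensure `k ≥ 2`, `1/k ≤ ε/8` and `h ≤ 1 - 1/k`.
  obtain ⟨k, hk⟩ := exists_nat_ge (2 + 8 / ε + 1 / (1 - h))
  have h1' : 0 < 1 - h := by linarith
  have p1 : 0 < 8 / ε := by positivity
  have p2 : 0 < 1 / (1 - h) := by positivity
  have hk2 : (2 : ℝ) ≤ k := by linarith
  have hk0 : (0 : ℝ) < k := by linarith
  have q1 : 1 / (k : ℝ) ≤ ε / 8 := by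
    have h3 : 8 / ε ≤ k := by linarith
    rw [div_le_iff₀ hε] at h3
    rw [div_le_div_iff₀ hk0 (by norm_num)]
    linarith
  have q2 : 1 / (k : ℝ) ≤ 1 - h := by
    have h3 : 1 / (1 - h) ≤ k := by linarith
    rw [div_le_iff₀ h1'] at h3
    rw [div_le_iff₀ hk0]
    linarith
  -- With this `e`, the loss from the optimum `1 - γ` is at most `(1 + ε) e / 16 = ε / 16`, also for
  -- large `ε`, and the concave terms cost `2 k² γ = e / 8`.
  set e := ε / (1 + ε) with he
  have e0 : 0 < e := by positivity
  have e1 : e ≤ 1 := by rw [he, div_le_one (by positivity)]; linarith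
  have e2 : e * (1 + ε) = ε := by rw [he]; field_simp
  have e3 : e ≤ ε := by nlinarith
  set γ := e / (16 * (k : ℝ) ^ 2) with hγ
  have g0 : 0 < γ := by positivity
  have g1 : (k : ℝ) ^ 2 * γ = e / 16 := by rw [hγ]; field_simp
  have g2 : γ * k ≤ (k : ℝ) ^ 2 * γ := by nlinarith
  have g3 : γ ≤ e / 16 := by nlinarith
  refine ⟨k, γ, by exact_mod_cast hk2, g0, by linarith, by nlinarith, by linarith, ?_⟩
  have g4 : (1 / 4 * (1 - h) + ε) * γ ≤ (1 + ε) * (e / 16) :=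
    mul_le_mul (by linarith) g3 g0.le (by linarith)
  rw [g1]
  nlinarith

end DRHardness

/-! ### Averaging over all hidden parts -/

theorem theorem3 :
    ∃ c : ℝ, 0 < c ∧ ∃ β : Polynomial ℕ,
      ∀ h : ℝ, 0 ≤ h → h < 1 → ∀ ε : ℝ, 0 < ε →
        ∃ (M : RamProg) (T : Polynomial ℕ),
          ∀ P : ℕ → ℕ, SubExponential P →
            ∀ (Ω : Type*) [MeasurableSpace Ω] (μ : Measure Ω) [IsProbabilityMeasure μ]
              (A : RandAlg Ω) (N : ℕ),
              ¬ Achieves μ A P ((1 / 4) * (1 - h) + ε) (IsInstance h c β T M) N := by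
  refine ⟨1 / 2, by norm_num, Polynomial.X, fun h h0 h1 ε hε => ?_⟩
  obtain ⟨k, γ, hk, hγ0, hγ1, hγk, hhk, hpar⟩ := exists_parameters h0 h1 hε
  obtain ⟨M, T, hM⟩ := exists_solvesLinear (k := k) h (by omega)
  refine ⟨M, T, fun P hP Ω _ μ _ A N hach => ?_⟩
  obtain ⟨s₀, Φ, Φ', Φ'', hs₀, hΦ⟩ := exists_isCutoff hγ0 (by linarith)
  have hk' : (2 : ℝ) ≤ k := by exact_mod_cast hk
  set η := (k : ℝ) ^ 2 * γ with hη
  have hη0 : 0 ≤ η := by positivity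
  -- Then `2 δ² ≤ 2 δ ≤ s₀`, so points near the full means lie where `Φ` vanishes.
  set δ := min 1 (s₀ / 2) with hδ
  have hδ0 : 0 < δ := lt_min one_pos (by linarith)
  have hδ1 : δ ≤ 1 := min_le_left _ _
  have hδs : δ ≤ s₀ / 2 := min_le_right _ _
  obtain ⟨N', hN'⟩ := exists_nat_ge (2 * k + 4 * η + 32)
  obtain ⟨m, hmN, hm⟩ := exists_large_dimension hP (k := k) (by omega) hδ0
    (half_pos hε) (k + 2 + 2 * η) (N + N' + 1)
  have hm0 : 0 < m := by omega
  have hmn : m ≤ m * (2 * k) := Nat.le_mul_of_pos_right m (by omega)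
  have hn : 2 * k + 4 * η + 32 ≤ m * (2 * k) := by
    have h3 : (N' : ℝ) ≤ ((m * (2 * k) : ℕ) : ℝ) := Nat.cast_le.2 (by omega)
    push_cast at h3
    linarith
  have hkη : k * (γ * (k - 1)) ≤ 2 * η := by
    rw [hη]
    nlinarith [mul_pos hγ0 (by linarith : (0 : ℝ) < k)]
  choose opt hopt hinst using fun σ : Fin m → Fin k =>
    exists_isInstance (hM m) hΦ hγ0.le hγ1 hm0 hk hγk hkη h0 hhk hn σ
  set α := 1 / 4 * (1 - h) + ε with hα
  have hα0 : 0 ≤ α := by linarith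
  have hrun := fun σ : Fin m → Fin k => hach _ _ _ (opt σ) (by omega) (hinst σ)
  -- There are finitely many `σ`, so almost every seed gives a deterministic algorithm that is
  -- correct for all of them at once.
  have hae := ae_all_iff.2 fun σ => (hrun σ).1
  set W := (k : ℝ) ^ m * (1 / 4 * (1 - h) + 1 / k + 2 * η +
    (k + 2 + 2 * η) * ((P (m * (2 * k)) + 1) * (4 * Real.exp (-(δ ^ 2 / 4 * m))))) with hW
  have hupper : ∑ σ : Fin m → Fin k, ENNReal.ofReal (α * opt σ) ≤ ENNReal.ofReal W := by
    calc ∑ σ : Fin m → Fin k, ENNReal.ofReal (α * opt σ)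
        ≤ ∑ σ : Fin m → Fin k, ∫⁻ ω, ENNReal.ofReal (hiddenObj η Φ σ
            ((A (m * (2 * k)) (constraintSet h m k) ω).result (hiddenObj η Φ σ))) ∂μ :=
          Finset.sum_le_sum fun σ _ => (hrun σ).2
      -- The algorithm need not be measurable in its seed; superadditivity of the lower integral is
      -- the direction needed.
      _ ≤ ∫⁻ ω, ∑ σ : Fin m → Fin k, ENNReal.ofReal (hiddenObj η Φ σ
            ((A (m * (2 * k)) (constraintSet h m k) ω).result (hiddenObj η Φ σ))) ∂μ :=
          sum_lintegral_le _ _ _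
      _ ≤ ∫⁻ _, ENNReal.ofReal W ∂μ := by
          refine lintegral_mono_ae (hae.mono fun ω hω => ?_)
          rw [← ENNReal.ofReal_sum_of_nonneg fun σ _ => (hinst σ).nonneg _
            ((hinst σ).subset_cube (hω σ).2)]
          exact ENNReal.ofReal_le_ofReal (sum_hiddenObj_result_le hΦ hγ0.le hm0 hk hη0 h0 h1 hδ0.le
            (by linarith) (by nlinarith) _ _ hω)
      _ = ENNReal.ofReal W := by simp
  have hopt0 : ∀ σ, 0 ≤ opt σ := fun σ => by linarith [hopt σ]
  rw [← ENNReal.ofReal_sum_of_nonneg fun σ _ => mul_nonneg hα0 (hopt0 σ),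
    ENNReal.ofReal_le_ofReal_iff (by positivity)] at hupper
  have hlower : (k : ℝ) ^ m * (α * (1 - γ)) ≤ ∑ σ : Fin m → Fin k, α * opt σ := by
    have h3 : ∑ _σ : Fin m → Fin k, α * (1 - γ) ≤ ∑ σ : Fin m → Fin k, α * opt σ :=
      Finset.sum_le_sum fun σ _ => mul_le_mul_of_nonneg_left (hopt σ) hα0
    simpa using h3
  have hfinal := le_of_mul_le_mul_left (hlower.trans hupper) (by positivity : (0 : ℝ) < k ^ m)
  linarith
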